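/- **Signals and uncertainty.** Let $\ell_2^{p}$ be the space of square-summable sequences $x(0),x(1),\dots$ in $\mathbf R^p$. Fix block sizes $m_1,\dots,m_s$ and $r_1,\dots,r_f$, and put $n_p=\sum_i m_i+\sum_j r_j$. Let $\boldsymbol\Delta$ be the set of operators $\Delta=\mathrm{diag}\{\delta_1 I_{m_1},\dots,\delta_s I_{m_s},\Delta_{s+1},\dots,\Delta_{s+f}\}$ on $\ell_2^{n_p}$, where $\delta_i:\ell_2^1\to\ell_2^1$ and $\Delta_{s+j}:\ell_2^{r_j}\to\ell_2^{r_j}$ are arbitrary linear (possibly time-varying) operators of $\ell_2$-induced norm at most $1$. Let $\mathcal D$ be the set of matrices $\mathrm{diag}\{D_1,\dots,D_s,d_{s+1}I_{r_1},\dots,d_{s+f}I_{r_f}\}$ with $D_i\in\mathbf R^{m_i\times m_i}$ symmetric positive definite and $d_{s+j}>0$. **System.** Consider the uncertain discrete-time system with measured state $x\in\mathbf R^n$, disturbance $d\in\mathbf R^{n_d}$, control $u\in\mathbf R^{n_u}$ and output $e\in\mathbf R^{n_e}$, $$x(k+1)=Ax(k)+B_0p(k)+B_1d(k)+B_2u(k),\quad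 q(k)=C_0x(k)+D_{00}p(k)+D_{02}u(k),$$ $$e(k)=C_1x(k)+D_{10}p(k)+D_{12}u(k),\qquad p=\Delta q,\quad \Delta\in\boldsymbol\Delta .$$ **$H_2$ norm.** For $f\in\ell_2^p$ let $f(\omega)$ be its Fourier transform, and for $\eta>0$ let $\mathcal W_\eta$ be the set of $f\in\ell_2^p$ such that every entry of $\int_0^s f(\omega)f(\omega)^\star\frac{d\omega}{2\pi}-\frac{s\|f\|^2}{2p\pi}I_p$ has absolute value less than $\eta$ for all $s\in[0,2\pi]$. For $T:\ell_2^p\to\ell_2^q$ put $\|T\|_{\mathcal W_\eta}=\sup\{\|Tf\|: f\in\mathcal W_\eta,\ \|f\|=1\}$ and $\|T\|_2=\sqrt p\,\lim_{\eta\downarrow0}\|T\|_{\mathcal W_\eta}$. The robust $H_2$ norm of an uncertain system is $\sup_{\Delta\in\boldsymbol\Delta}\|T_\Delta\|_2$, where $T_\Delta$ is the map from $d$ to $e$ with zero initial state. **Robust stability.** An uncertain system is robustly stable if (i) there is a constant $C$ such that for every $\Delta\in\boldsymbol\Delta$, every initial state $x_0$, every $d\in\ell_2^{n_d}$ and every signal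 $w\in\ell_2^{n_p}$ added to the output of $\Delta$ (so that $p=\Delta q+w$), there is exactly one solution $(x,p,q,e)$ in $\ell_2$, and $\|x\|+\|p\|+\|q\|+\|e\|\le C(\|x_0\|+\|d\|+\|w\|)$; and (ii) for causal $\Delta\in\boldsymbol\Delta$ every solution among all sequences (not assumed square-summable) is in $\ell_2$. **Theorem.** Let $\gamma>0$. Suppose there are symmetric positive definite matrices $P_-,P_+\in\mathbf R^{n\times n}$ and $Q\in\mathbf R^{n_d\times n_d}$, a scaling $X\in\mathcal D$, and matrices $M\in\mathbf R^{n_u\times n}$, $V\in\mathbf R^{n\times n}$ such that, for $P=P_+$ and for $P=P_-$, $$\begin{bmatrix} V^T+V-P&0&(AV+B_2M)^T&(C_0V+D_{02}M)^T&(C_1V+D_{12}M)^T\\ 0&X&XB_0^T&XD_{00}^T&XD_{10}^T\\ AV+B_2M&B_0X&P&0&0\\ C_0V+D_{02}M&D_{00}X&0&X&0\\ C_1V+D_{12}M&D_{10}X&0&0&I \end{bmatrix}>0,$$ and $$\begin{bmatrix}Q&B_1^T\\B_1&P_+-P_-\end{bmatrix}>0,\qquad \mathrm{tr}(Q)<\gamma^2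 .$$ Then $V$ is invertible, the closed loop with the state feedback $u(k)=MV^{-1}x(k)$ is robustly stable, and its robust $H_2$ norm is less than $\gamma$. -/

import Mathlib

open Filter Topology MeasureTheory
open scoped ENNReal Matrix ComplexConjugate

noncomputable section

namespace RobustH2

/-! ### Square-summable signals -/

/-- The space `ℓ₂` of square-summable sequences `x(0), x(1), x(2), …` of real vectors with
coordinates indexed by `ι`, with the Euclidean norm at each time. -/
abbrev Signal (ι : Type) [Fintype ι] := lp (fun _ : ℕ => EuclideanSpace ℝ ι) 2

/-- The space `ℓ₂` of square-summable real sequences. -/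
abbrev ScalarSignal := lp (fun _ : ℕ => ℝ) 2

/-- The scalar signal formed by the coordinate `c` of a vector signal. -/
def coord {ι : Type} [Fintype ι] (c : ι) (x : Signal ι) : ScalarSignal :=
  ⟨fun k => x k c, (lp.memℓp x).mono' fun k => PiLp.norm_apply_le (x k) c⟩

theorem norm_comp_le {ι κ : Type} [Fintype ι] [Fintype κ] {g : κ → ι}
    (hg : Function.Injective g) (v : EuclideanSpace ℝ ι) :
    ‖(WithLp.toLp 2 fun a => v (g a) : EuclideanSpace ℝ κ)‖ ≤ ‖v‖ := by
  classical
  rw [EuclideanSpace.norm_eq, EuclideanSpace.norm_eq]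
  refine Real.sqrt_le_sqrt ?_
  calc ∑ a, ‖v (g a)‖ ^ 2 = ∑ c ∈ Finset.univ.map ⟨g, hg⟩, ‖v c‖ ^ 2 := by
        rw [Finset.sum_map]; rfl
    _ ≤ ∑ c, ‖v c‖ ^ 2 :=
        Finset.sum_le_sum_of_subset_of_nonneg (Finset.subset_univ _) fun _ _ _ => sq_nonneg _

/-- The vector signal formed by the coordinates `g a`, `a : κ`, of a vector signal. -/
def block {ι κ : Type} [Fintype ι] [Fintype κ] (g : κ ↪ ι) (x : Signal ι) : Signal κ :=
  ⟨fun k => WithLp.toLp 2 fun a => x k (g a),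
    (lp.memℓp x).mono' fun k => norm_comp_le g.injective (x k)⟩

/-! ### The structured uncertainty and the scalings -/

/-- The index set of the uncertainty channel: `s` repeated scalar blocks of sizes `m 0, m 1, …`,
followed by `f` full blocks of sizes `r 0, r 1, …`. It has `∑ i, m i + ∑ j, r j` elements. -/
abbrev Chan {s f : ℕ} (m : Fin s → ℕ) (r : Fin f → ℕ) : Type :=
  (Σ i : Fin s, Fin (m i)) ⊕ (Σ j : Fin f, Fin (r j))

/-- The inclusion of the `j`-th full block in the uncertainty channel. -/
def fullBlock {s f : ℕ} (m : Fin s → ℕ) (r : Fin f → ℕ) (j : Fin f) : Fin (r j) ↪ Chan m r :=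
  ⟨fun a => Sum.inr ⟨j, a⟩, fun a b h => by simpa using h⟩

/-- The structured uncertainty set: the operators
`diag (δ₁ I_{m₁}, …, δ_s I_{m_s}, Δ_{s+1}, …, Δ_{s+f})` on `ℓ₂`, where the `δᵢ` (on scalar signals)
and the `Δ_{s+j}` (on vector signals of dimension `r j`) are linear operators of `ℓ₂`-induced norm
at most one. -/
def uncertaintySet {s f : ℕ} (m : Fin s → ℕ) (r : Fin f → ℕ) :
    Set (Signal (Chan m r) →L[ℝ] Signal (Chan m r)) :=
  {Δ | ∃ (δ : Fin s → ScalarSignal →L[ℝ] ScalarSignal)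
      (Δf : ∀ j : Fin f, Signal (Fin (r j)) →L[ℝ] Signal (Fin (r j))),
      (∀ i, ‖δ i‖ ≤ 1) ∧ (∀ j, ‖Δf j‖ ≤ 1) ∧
      ∀ q : Signal (Chan m r),
        (∀ (i : Fin s) (a : Fin (m i)),
          coord (Sum.inl ⟨i, a⟩) (Δ q) = δ i (coord (Sum.inl ⟨i, a⟩) q)) ∧
        (∀ j : Fin f, block (fullBlock m r j) (Δ q) = Δf j (block (fullBlock m r j) q))}

/-- The set `𝒟` of scalings `diag (D₁, …, D_s, d_{s+1} I_{r₁}, …, d_{s+f} I_{r_f})` with `Dᵢ`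
symmetric positive definite and `d_{s+j} > 0`. -/
def scalingSet {s f : ℕ} (m : Fin s → ℕ) (r : Fin f → ℕ) :
    Set (Matrix (Chan m r) (Chan m r) ℝ) :=
  {X | ∃ (D : ∀ i : Fin s, Matrix (Fin (m i)) (Fin (m i)) ℝ) (d : Fin f → ℝ),
      (∀ i, (D i).PosDef) ∧ (∀ j, 0 < d j) ∧
      X = Matrix.fromBlocks (Matrix.blockDiagonal' D) 0 0
        (Matrix.blockDiagonal' fun j => d j • (1 : Matrix (Fin (r j)) (Fin (r j)) ℝ))}

/-- A causal operator on signals: the output up to time `k` depends only on the input up to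
time `k`. -/
def Causal {ι κ : Type} [Fintype ι] [Fintype κ] (T : Signal ι → Signal κ) : Prop :=
  ∀ (k : ℕ) (q q' : Signal ι), (∀ l ≤ k, q l = q' l) → T q k = T q' k

/-! ### The uncertain system and its closed loop -/

/-- The data of the nominal part of the uncertain system
`x(k+1) = A x + B₀ p + B₁ d`, `q = C₀ x + D₀₀ p`, `e = C₁ x + D₁₀ p`, with `p = Δ q`. -/
structure LFTSystem (n np nd ne : Type) where
  A : Matrix n n ℝ
  B₀ : Matrix n np ℝ
  B₁ : Matrix n nd ℝ
  C₀ : Matrix np n ℝ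
  D₀₀ : Matrix np np ℝ
  C₁ : Matrix ne n ℝ
  D₁₀ : Matrix ne np ℝ

/-- The data of the nominal part of the uncertain system with control input
`x(k+1) = A x + B₀ p + B₁ d + B₂ u`, `q = C₀ x + D₀₀ p + D₀₂ u`, `e = C₁ x + D₁₀ p + D₁₂ u`,
with `p = Δ q`; the whole state `x` is measured. -/
structure LFTPlant (n np nd ne nu : Type) extends LFTSystem n np nd ne where
  B₂ : Matrix n nu ℝ
  D₀₂ : Matrix np nu ℝ
  D₁₂ : Matrix ne nu ℝ

/-- The closed loop of the plant with the state feedback `u = F x`. -/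
def LFTPlant.closedLoop {n np nd ne nu : Type} [Fintype nu] (G : LFTPlant n np nd ne nu)
    (F : Matrix nu n ℝ) : LFTSystem n np nd ne where
  A := G.A + G.B₂ * F
  B₀ := G.B₀
  B₁ := G.B₁
  C₀ := G.C₀ + G.D₀₂ * F
  D₀₀ := G.D₀₀
  C₁ := G.C₁ + G.D₁₂ * F
  D₁₀ := G.D₁₀

namespace LFTSystem

variable {n np nd ne : Type} [Fintype n] [Fintype np] [Fintype nd] [Fintype ne]

/-- The nominal equations with initial state `x₀`, for arbitrary (not necessarily
square-summable) sequences. -/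
def Equations (G : LFTSystem n np nd ne) (x₀ : EuclideanSpace ℝ n)
    (d : ℕ → EuclideanSpace ℝ nd) (x : ℕ → EuclideanSpace ℝ n) (p q : ℕ → EuclideanSpace ℝ np)
    (e : ℕ → EuclideanSpace ℝ ne) : Prop :=
  x 0 = x₀ ∧ ∀ k,
    (x (k + 1)).ofLp = G.A *ᵥ (x k).ofLp + G.B₀ *ᵥ (p k).ofLp + G.B₁ *ᵥ (d k).ofLp ∧
    (q k).ofLp = G.C₀ *ᵥ (x k).ofLp + G.D₀₀ *ᵥ (p k).ofLp ∧
    (e k).ofLp = G.C₁ *ᵥ (x k).ofLp + G.D₁₀ *ᵥ (p k).ofLp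

/-- The `ℓ₂` trajectories of the uncertain system for a given uncertainty `Δ`, with initial state
`x₀`, disturbance `d` and an extra signal `w` injected at the output of the uncertainty. -/
def IsTrajectory (G : LFTSystem n np nd ne) (Δ : Signal np →L[ℝ] Signal np)
    (x₀ : EuclideanSpace ℝ n) (d : Signal nd) (w : Signal np)
    (x : Signal n) (p q : Signal np) (e : Signal ne) : Prop :=
  G.Equations x₀ d x p q e ∧ p = Δ q + w

/-- Robust stability against the set `U`.

* The interconnection is well-posed and stable on `ℓ₂`, uniformly over `U`: for every `Δ`, every
  initial state and all `ℓ₂` inputs there is exactly one `ℓ₂` trajectory, and it is bounded by the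
  data with a constant that does not depend on `Δ`.
* For causal `Δ`, every solution of the equations among all sequences (where a causal `Δ` acts on
  an arbitrary sequence through its values up to the present time) is square-summable. -/
def RobustlyStable (G : LFTSystem n np nd ne) (U : Set (Signal np →L[ℝ] Signal np)) : Prop :=
  (∃ C : ℝ, ∀ Δ ∈ U, ∀ (x₀ : EuclideanSpace ℝ n) (d : Signal nd) (w : Signal np),
    ∃ (x : Signal n) (p q : Signal np) (e : Signal ne),
      G.IsTrajectory Δ x₀ d w x p q e ∧
      (∀ x' p' q' e', G.IsTrajectory Δ x₀ d w x' p' q' e' →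
        x' = x ∧ p' = p ∧ q' = q ∧ e' = e) ∧
      ‖x‖ + ‖p‖ + ‖q‖ + ‖e‖ ≤ C * (‖x₀‖ + ‖d‖ + ‖w‖)) ∧
  (∀ Δ ∈ U, Causal Δ → ∀ (x₀ : EuclideanSpace ℝ n) (d : Signal nd) (w : Signal np)
    (x : ℕ → EuclideanSpace ℝ n) (p q : ℕ → EuclideanSpace ℝ np) (e : ℕ → EuclideanSpace ℝ ne),
    G.Equations x₀ d x p q e →
    (∀ (k : ℕ) (q' : Signal np), (∀ l ≤ k, q' l = q l) → p k = Δ q' k + w k) →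
    Memℓp x 2 ∧ Memℓp p 2 ∧ Memℓp q 2 ∧ Memℓp e 2)

/-- `T` is the map from the disturbance `d` to the output `e` of the uncertain system with
uncertainty `Δ`, for zero initial state. -/
def IsDisturbanceMap (G : LFTSystem n np nd ne) (Δ : Signal np →L[ℝ] Signal np)
    (T : Signal nd → Signal ne) : Prop :=
  ∀ (d : Signal nd) (e : Signal ne),
    (∃ (x : Signal n) (p q : Signal np), G.IsTrajectory Δ 0 d 0 x p q e) ↔ e = T d

end LFTSystem

/-! ### White-noise sets and the `H₂` norm of a system -/

instance fact_two_pi_pos : Fact (0 < 2 * Real.pi) := ⟨Real.two_pi_pos⟩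

/-- The Fourier transform `f(ω) = ∑ₖ f(k) e^{-iωk}` of a scalar `ℓ₂` signal, as a
square-integrable function on the circle `ℝ / 2πℤ` (the series converges in `L²`, see
`hasSum_fourierTransform`). -/
def fourierTransform (f : ScalarSignal) :
    Lp ℂ 2 (AddCircle.haarAddCircle (T := 2 * Real.pi)) :=
  ∑' k : ℕ, (f k : ℂ) • fourierLp 2 (-(k : ℤ))

theorem hasSum_fourierTransform (f : ScalarSignal) :
    HasSum (fun k : ℕ => (f k : ℂ) • fourierLp (T := 2 * Real.pi) 2 (-(k : ℤ)))
      (fourierTransform f) := by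
  have hinj : Function.Injective fun k : ℕ => -(k : ℤ) := fun a b h => by simpa using h
  have ho := (orthonormal_fourier (T := 2 * Real.pi)).comp _ hinj
  refine Summable.hasSum ?_
  have hf : Summable fun k : ℕ => ‖(f k : ℂ)‖ ^ 2 := by
    have := (lp.memℓp f).summable (by norm_num)
    simpa using this
  exact (ho.orthogonalFamily.summable_iff_norm_sq_summable fun k => (f k : ℂ)).2 hf

/-- The entry `(a, b)` of the cumulative spectrum `∫₀ˢ f(ω) f(ω)⋆ dω / 2π` of a signal. -/
def cumulativeSpectrum {ι : Type} [Fintype ι] (f : Signal ι) (s : ℝ) : Matrix ι ι ℂ :=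
  fun a b => ∫ ω in (0 : ℝ)..s,
    (fourierTransform (coord a f) : AddCircle (2 * Real.pi) → ℂ) (ω : AddCircle (2 * Real.pi)) *
      conj ((fourierTransform (coord b f) : AddCircle (2 * Real.pi) → ℂ)
        (ω : AddCircle (2 * Real.pi))) / (2 * Real.pi)

/-- The set `𝒲_η` of signals `f` of dimension `p` whose cumulative spectrum differs from
`s ‖f‖² / (2 p π) • I`, the one of white noise, by less than `η` in every entry, for all
`s ∈ [0, 2π]`. -/
def whiteNoiseSet (p : ℕ) (η : ℝ) : Set (Signal (Fin p)) :=
  {f | ∀ s ∈ Set.Icc 0 (2 * Real.pi), ∀ a b : Fin p,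
    ‖(cumulativeSpectrum f s
      - ((s * ‖f‖ ^ 2 / (2 * p * Real.pi) : ℝ) : ℂ) • (1 : Matrix (Fin p) (Fin p) ℂ)) a b‖ < η}

/-- The gain `‖T‖_{𝒲_η} = sup {‖T f‖ : f ∈ 𝒲_η, ‖f‖ = 1}`. -/
def whiteNoiseGain {p q : ℕ} (T : Signal (Fin p) → Signal (Fin q)) (η : ℝ) : ℝ≥0∞ :=
  ⨆ f ∈ {f ∈ whiteNoiseSet p η | ‖f‖ = 1}, ENNReal.ofReal ‖T f‖

theorem whiteNoiseGain_mono {p q : ℕ} (T : Signal (Fin p) → Signal (Fin q)) :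
    Monotone (whiteNoiseGain T) := fun _ _ h =>
  biSup_mono fun _ hf => ⟨fun s hs a b => (hf.1 s hs a b).trans_le h, hf.2⟩

/-- The `H₂` norm `√p · lim_{η → 0} ‖T‖_{𝒲_η}` of a system with `p` inputs; the limit always exists
in `[0, ∞]`, see `tendsto_whiteNoiseGain`. -/
def h2Norm {p q : ℕ} (T : Signal (Fin p) → Signal (Fin q)) : ℝ≥0∞ :=
  ENNReal.ofReal (Real.sqrt p) * limUnder (𝓝[>] (0 : ℝ)) (whiteNoiseGain T)

theorem tendsto_whiteNoiseGain {p q : ℕ} (T : Signal (Fin p) → Signal (Fin q)) :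
    Tendsto (whiteNoiseGain T) (𝓝[>] (0 : ℝ)) (𝓝 (limUnder (𝓝[>] (0 : ℝ)) (whiteNoiseGain T))) :=
  tendsto_nhds_limUnder ⟨_, (whiteNoiseGain_mono T).tendsto_nhdsGT 0⟩

/-- The robust `H₂` norm: the worst `H₂` norm over the uncertainty set, where `T Δ` is the
disturbance-to-output map for the uncertainty `Δ`. -/
def robustH2Norm {np : Type} [Fintype np] {p q : ℕ} (U : Set (Signal np →L[ℝ] Signal np))
    (T : (Signal np →L[ℝ] Signal np) → Signal (Fin p) → Signal (Fin q)) : ℝ≥0∞ :=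
  ⨆ Δ ∈ U, h2Norm (T Δ)

/-! ### The synthesis inequality -/

/-- The 5 × 5 block matrix of the synthesis condition for the plant `G` (with block rows and columns
grouped as 2 + 3), as a function of `P, X, M, V`. -/
def LFTPlant.synthesisMatrix {n np nd ne nu : Type} [Fintype n] [Fintype np] [Fintype nu]
    [DecidableEq ne] (G : LFTPlant n np nd ne nu)
    (P : Matrix n n ℝ) (X : Matrix np np ℝ) (M : Matrix nu n ℝ) (V : Matrix n n ℝ) :
    Matrix ((n ⊕ np) ⊕ (n ⊕ (np ⊕ ne))) ((n ⊕ np) ⊕ (n ⊕ (np ⊕ ne))) ℝ :=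
  Matrix.fromBlocks
    (Matrix.fromBlocks (Vᵀ + V - P) 0 0 X)
    (Matrix.fromRows
      (Matrix.fromCols (G.A * V + G.B₂ * M)ᵀ
        (Matrix.fromCols (G.C₀ * V + G.D₀₂ * M)ᵀ (G.C₁ * V + G.D₁₂ * M)ᵀ))
      (Matrix.fromCols (X * G.B₀ᵀ) (Matrix.fromCols (X * G.D₀₀ᵀ) (X * G.D₁₀ᵀ))))
    (Matrix.fromCols
      (Matrix.fromRows (G.A * V + G.B₂ * M)
        (Matrix.fromRows (G.C₀ * V + G.D₀₂ * M) (G.C₁ * V + G.D₁₂ * M)))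
      (Matrix.fromRows (G.B₀ * X) (Matrix.fromRows (G.D₀₀ * X) (G.D₁₀ * X))))
    (Matrix.fromBlocks P 0 0 (Matrix.fromBlocks X 0 0 1))

end RobustH2

end

/-! Write `R = P⁻¹`, `Y = X⁻¹`, `z = (x, p)`. Testing the synthesis inequality on suitable vectors
shows that, for `P₊` and for `P₋`, the form `|x|²_R + |p|²_Y - |A x + B₀ p|²_R - |C₀ x + D₀₀ p|²_Y -
|C₁ x + D₁₀ p|²` of the closed loop is positive definite (`LFTPlant.dissipationMatrix_posDef`). A
scaling commutes with the block structure, so no uncertainty increases the `Y`-energy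
(`inner_scaling_uncertainty_le`).

Stability: the loop equations read `z = T z + input`, where `T` strictly decreases the energy
weighted by `R` and `Y`, by a margin independent of `Δ`. A coercivity argument inverts `1 - T` with
a uniform bound, even for noncausal `Δ` (`exists_sub_eq`, `norm_le_mul_norm_sub`). For causal `Δ`,
truncation shows that an arbitrary solution equals the `ℓ₂` one.

`H₂` norm: let `R = P₊⁻¹`, `b = B₁ d`, let `σ` be the left shift and `H` the dissipation matrix.
Summing the energy balance gives `‖e‖² ≤ 2⟪σx, R b⟫ - ⟪b, R b⟫ - ⟪z, H z⟫`. As `Δ` may use the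
future of `d`, the cross term between `A x + B₀ p` and `R b` need not vanish for white noise.
Instead `R b` is written as `μ - σ L μ` plus a small remainder, with `μ` an anticausal filter of
`d`; the cross term becomes `⟪z, H Z μ⟫ + ⟪b, μ⟫`, and completing the square removes `z`
(`LFTSystem.norm_sq_output_le`). What remains, apart from the remainder, depends on `d` only,
through a fixed finite filter.

The second matrix `P₋` supplies `L` and `Z` together with a strict Lyapunov inequality for `Θ =
(P₋⁻¹ - P₊⁻¹)⁻¹` (`LFTSystem.exists_filter`). White-noise autocorrelations then bound the filter
energy by `tr B₁ᵀ (R Θ R + R) B₁ = tr B₁ᵀ (P₊ - P₋)⁻¹ B₁`, divided by the number of inputs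
(`whiteNoiseBound_anticausalFilter`, `inv_mul_inv_sub_inv_mul_inv`), and a Schur complement bounds
this trace by `tr Q < γ²`. -/

noncomputable section

namespace RobustH2

open scoped InnerProductSpace

/-! ### Pointwise operators and shifts on signals -/

section SequenceOperators

variable {E F : Type*} [NormedAddCommGroup E] [NormedAddCommGroup F]

theorem memℓp_two_succ {x : ℕ → E} (hx : Memℓp x 2) : Memℓp (fun k => x (k + 1)) 2 := by
  rw [memℓp_gen_iff (by norm_num)] at hx ⊢
  exact (summable_nat_add_iff (f := fun k => ‖x k‖ ^ (2 : ℝ≥0∞).toReal) 1).2 hx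

theorem norm_sq_eq_tsum (x : lp (fun _ : ℕ => E) 2) : ‖x‖ ^ 2 = ∑' k, ‖x k‖ ^ 2 := by
  have := lp.norm_rpow_eq_tsum (by norm_num) x
  simpa using this

theorem summable_norm_sq (x : lp (fun _ : ℕ => E) 2) : Summable fun k => ‖x k‖ ^ 2 := by
  have := (lp.memℓp x).summable (by norm_num)
  simpa using this

variable [NormedSpace ℝ E] [NormedSpace ℝ F]

/-- A continuous linear map acting at each time on square-summable sequences. -/
def pointwise (T : E →L[ℝ] F) : lp (fun _ : ℕ => E) 2 →L[ℝ] lp (fun _ : ℕ => F) 2 :=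
  LinearMap.mkContinuous
    { toFun := fun x => ⟨fun k => T (x k), by
        refine (lp.memℓp (‖T‖ • x)).mono' fun k => ?_
        simpa [norm_smul] using T.le_opNorm (x k)⟩
      map_add' := fun x y => by ext k; exact T.map_add _ _
      map_smul' := fun c x => by ext k; simp }
    ‖T‖ fun x => by
      have h : ‖‖T‖ • x‖ = ‖T‖ * ‖x‖ := by rw [norm_smul, norm_norm]
      rw [← h]
      refine lp.norm_mono (by norm_num) fun k => ?_
      simpa [norm_smul] using T.le_opNorm (x k)

@[simp] theorem pointwise_apply (T : E →L[ℝ] F) (x : lp (fun _ : ℕ => E) 2) (k : ℕ) :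
    pointwise T x k = T (x k) := rfl

/-- The left shift. -/
def leftShift : lp (fun _ : ℕ => E) 2 →L[ℝ] lp (fun _ : ℕ => E) 2 :=
  LinearMap.mkContinuous
    { toFun := fun x => ⟨fun k => x (k + 1), memℓp_two_succ (lp.memℓp x)⟩
      map_add' := fun x y => by ext k; rfl
      map_smul' := fun c x => by ext k; simp }
    1 fun x => by
      rw [one_mul]
      refine (sq_le_sq₀ (norm_nonneg _) (norm_nonneg _)).1 ?_
      rw [norm_sq_eq_tsum, norm_sq_eq_tsum, (summable_norm_sq x).tsum_eq_zero_add]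
      exact le_add_of_nonneg_left (by positivity)

@[simp] theorem leftShift_apply (x : lp (fun _ : ℕ => E) 2) (k : ℕ) :
    leftShift x k = x (k + 1) := rfl

/-- The right shift. -/
def rightShift : lp (fun _ : ℕ => E) 2 →ₗᵢ[ℝ] lp (fun _ : ℕ => E) 2 where
  toFun x := ⟨fun k => Nat.casesOn k 0 fun l => x l, by
    have h := lp.memℓp x
    refine (memℓp_gen_iff (by norm_num)).2 ?_
    rw [memℓp_gen_iff (by norm_num)] at h
    exact (summable_nat_add_iff 1).1 h⟩
  map_add' x y := by
    ext k
    cases k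
    · exact (add_zero _).symm
    · rfl
  map_smul' c x := by ext k; cases k <;> simp
  norm_map' x := by
    refine (sq_eq_sq₀ (norm_nonneg _) (norm_nonneg _)).1 ?_
    rw [norm_sq_eq_tsum, norm_sq_eq_tsum, (summable_norm_sq _).tsum_eq_zero_add]
    simp

@[simp] theorem rightShift_zero (x : lp (fun _ : ℕ => E) 2) : rightShift x 0 = 0 := rfl

@[simp] theorem rightShift_succ (x : lp (fun _ : ℕ => E) 2) (k : ℕ) :
    rightShift x (k + 1) = x k := rfl

@[simp] theorem leftShift_rightShift (x : lp (fun _ : ℕ => E) 2) :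
    leftShift (rightShift x) = x := by ext k; simp

theorem rightShift_leftShift {x : lp (fun _ : ℕ => E) 2} (hx : x 0 = 0) :
    rightShift (leftShift x) = x := by
  ext k
  cases k <;> simp [hx]

theorem rightShift_pointwise (T : E →L[ℝ] F) (x : lp (fun _ : ℕ => E) 2) :
    rightShift (pointwise T x) = pointwise T (rightShift x) := by
  ext k; cases k <;> simp

theorem norm_leftShift_le (x : lp (fun _ : ℕ => E) 2) : ‖leftShift x‖ ≤ ‖x‖ := by
  have h : ‖leftShift (E := E)‖ ≤ 1 := LinearMap.mkContinuous_norm_le _ zero_le_one _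
  simpa using (leftShift (E := E)).le_of_opNorm_le h x

end SequenceOperators

section Inner

variable {E : Type*} [NormedAddCommGroup E] [InnerProductSpace ℝ E]

theorem summable_inner_apply (x y : lp (fun _ : ℕ => E) 2) :
    Summable fun k => ⟪x k, y k⟫_ℝ := lp.summable_inner x y

theorem inner_eq_inner_zero_add (x y : lp (fun _ : ℕ => E) 2) :
    ⟪x, y⟫_ℝ = ⟪x 0, y 0⟫_ℝ + ⟪leftShift x, leftShift y⟫_ℝ := by
  rw [lp.inner_eq_tsum, lp.inner_eq_tsum]
  exact (summable_inner_apply x y).tsum_eq_zero_add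

theorem inner_rightShift (x y : lp (fun _ : ℕ => E) 2) :
    ⟪rightShift x, y⟫_ℝ = ⟪x, leftShift y⟫_ℝ := by
  rw [inner_eq_inner_zero_add]
  simp

theorem inner_leftShift_leftShift {x y : lp (fun _ : ℕ => E) 2} (hx : x 0 = 0) :
    ⟪leftShift x, leftShift y⟫_ℝ = ⟪x, y⟫_ℝ := by
  rw [← inner_rightShift, rightShift_leftShift hx]

end Inner

/-! ### Matrices acting on signals -/

section MatrixOperators

variable {ι κ τ : Type} [Fintype ι] [Fintype κ] [Fintype τ]

/-- The continuous linear map of Euclidean spaces given by a matrix. -/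
def matCLM (A : Matrix κ ι ℝ) : EuclideanSpace ℝ ι →L[ℝ] EuclideanSpace ℝ κ :=
  LinearMap.toContinuousLinearMap
    { toFun := fun x => WithLp.toLp 2 (A *ᵥ x.ofLp)
      map_add' := fun x y => by simp [Matrix.mulVec_add]
      map_smul' := fun c x => by simp [Matrix.mulVec_smul] }

@[simp] theorem matCLM_apply (A : Matrix κ ι ℝ) (x : EuclideanSpace ℝ ι) :
    matCLM A x = WithLp.toLp 2 (A *ᵥ x.ofLp) := rfl

/-- A matrix acting at each time on vector signals. -/
def matSig (A : Matrix κ ι ℝ) : Signal ι →L[ℝ] Signal κ := pointwise (matCLM A)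

@[simp] theorem matSig_apply (A : Matrix κ ι ℝ) (x : Signal ι) (k : ℕ) :
    matSig A x k = WithLp.toLp 2 (A *ᵥ (x k).ofLp) := rfl

theorem matSig_matSig (A : Matrix τ κ ℝ) (B : Matrix κ ι ℝ) (x : Signal ι) :
    matSig A (matSig B x) = matSig (A * B) x := by
  ext k : 2; simp [Matrix.mulVec_mulVec]

theorem matSig_rightShift (A : Matrix κ ι ℝ) (x : Signal ι) :
    matSig A (rightShift x) = rightShift (matSig A x) := (rightShift_pointwise _ _).symm

theorem matSig_leftShift (A : Matrix κ ι ℝ) (x : Signal ι) :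
    matSig A (leftShift x) = leftShift (matSig A x) := rfl

theorem matSig_sub (A B : Matrix κ ι ℝ) (x : Signal ι) :
    matSig (A - B) x = matSig A x - matSig B x := by
  ext k : 2; simp [Matrix.sub_mulVec]

theorem matSig_smul (c : ℝ) (A : Matrix κ ι ℝ) (x : Signal ι) :
    matSig (c • A) x = c • matSig A x := by
  ext k : 2; simp [Matrix.smul_mulVec]

theorem matSig_one [DecidableEq ι] (x : Signal ι) : matSig (1 : Matrix ι ι ℝ) x = x := by
  ext k : 2; simp

theorem inner_toLp_mulVec (A : Matrix κ ι ℝ) (x : ι → ℝ) (y : κ → ℝ) :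
    ⟪(WithLp.toLp 2 (A *ᵥ x) : EuclideanSpace ℝ κ), WithLp.toLp 2 y⟫_ℝ
      = ⟪(WithLp.toLp 2 x : EuclideanSpace ℝ ι), WithLp.toLp 2 (Aᵀ *ᵥ y)⟫_ℝ := by
  simp only [EuclideanSpace.inner_toLp_toLp, star_trivial]
  rw [Matrix.mulVec_transpose, Matrix.dotProduct_mulVec]

theorem inner_matSig (A : Matrix κ ι ℝ) (x : Signal ι) (y : Signal κ) :
    ⟪matSig A x, y⟫_ℝ = ⟪x, matSig Aᵀ y⟫_ℝ := by
  rw [lp.inner_eq_tsum, lp.inner_eq_tsum]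
  exact tsum_congr fun k => inner_toLp_mulVec A (x k).ofLp (y k).ofLp

theorem inner_matSig_nonneg {H : Matrix ι ι ℝ} (hH : H.PosSemidef) (x : Signal ι) :
    0 ≤ ⟪x, matSig H x⟫_ℝ := by
  rw [lp.inner_eq_tsum]
  refine tsum_nonneg fun k => ?_
  have := hH.dotProduct_mulVec_nonneg (x k).ofLp
  simpa [EuclideanSpace.inner_eq_star_dotProduct, dotProduct_comm] using this

theorem inner_matSig_leftShift_le {H : Matrix ι ι ℝ} (hH : H.PosSemidef) (x : Signal ι) :
    ⟪leftShift x, matSig H (leftShift x)⟫_ℝ ≤ ⟪x, matSig H x⟫_ℝ := by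
  rw [inner_eq_inner_zero_add x]
  refine le_add_of_nonneg_left ?_
  have := hH.dotProduct_mulVec_nonneg (x 0).ofLp
  simpa [EuclideanSpace.inner_eq_star_dotProduct, dotProduct_comm] using this

/-- A positive definite matrix is bounded below by a positive multiple of the identity. -/
theorem exists_pos_mul_dotProduct_le {H : Matrix ι ι ℝ} (hH : H.PosDef) :
    ∃ ε : ℝ, 0 < ε ∧ ∀ v : ι → ℝ, ε * (v ⬝ᵥ v) ≤ v ⬝ᵥ H *ᵥ v := by
  let φ : EuclideanSpace ℝ ι → ℝ := fun v => v.ofLp ⬝ᵥ H *ᵥ v.ofLp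
  have hφ : Continuous φ := by
    simp only [φ, dotProduct, Matrix.mulVec]
    fun_prop
  have hpos : ∀ v : EuclideanSpace ℝ ι, v ≠ 0 → 0 < φ v := fun v hv => by
    have := hH.dotProduct_mulVec_pos (x := v.ofLp) (by simpa using hv)
    simpa using this
  have hsc : ∀ (c : ℝ) (v : EuclideanSpace ℝ ι), φ (c • v) = c ^ 2 * φ v := fun c v => by
    simp [φ, Matrix.mulVec_smul]; ring
  obtain ⟨ε, hε, h⟩ : ∃ ε : ℝ, 0 < ε ∧ ∀ v ∈ Metric.sphere (0 : EuclideanSpace ℝ ι) 1, ε ≤ φ v := by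
    rcases (Metric.sphere (0 : EuclideanSpace ℝ ι) 1).eq_empty_or_nonempty with he | hne
    · exact ⟨1, one_pos, by simp [he]⟩
    · obtain ⟨v, hv, hmin⟩ := (isCompact_sphere _ _).exists_isMinOn hne hφ.continuousOn
      refine ⟨φ v, hpos v ?_, fun w hw => hmin hw⟩
      rintro rfl
      simp at hv
  refine ⟨ε, hε, fun v => ?_⟩
  rcases eq_or_ne v 0 with rfl | hv
  · simp
  set w : EuclideanSpace ℝ ι := WithLp.toLp 2 v
  have hw : w ≠ 0 := by simpa [w] using hv
  have hn : 0 < ‖w‖ := norm_pos_iff.2 hw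
  have h1 := h (‖w‖⁻¹ • w) (by simp [norm_smul, hn.ne'])
  rw [hsc] at h1
  have h2 : v ⬝ᵥ v = ‖w‖ ^ 2 := by
    rw [← real_inner_self_eq_norm_sq]; simp only [w, EuclideanSpace.inner_toLp_toLp, star_trivial]
  rw [h2]
  calc ε * ‖w‖ ^ 2 ≤ (‖w‖⁻¹ ^ 2 * φ w) * ‖w‖ ^ 2 := by gcongr
    _ = φ w := by field_simp
    _ = _ := rfl

theorem posSemidef_sub_smul_one [DecidableEq ι] {H : Matrix ι ι ℝ} (hH : H.PosDef) :
    ∃ ε : ℝ, 0 < ε ∧ (H - ε • (1 : Matrix ι ι ℝ)).PosSemidef := by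
  obtain ⟨ε, hε, h⟩ := exists_pos_mul_dotProduct_le hH
  refine ⟨ε, hε, .of_dotProduct_mulVec_nonneg
    (hH.1.sub (Matrix.isHermitian_one.smul (IsSelfAdjoint.all ε))) fun v => ?_⟩
  simpa [Matrix.sub_mulVec, Matrix.smul_mulVec] using h v

theorem exists_pos_mul_norm_sq_le {H : Matrix ι ι ℝ} (hH : H.PosDef) :
    ∃ ε : ℝ, 0 < ε ∧ ∀ x : Signal ι, ε * ‖x‖ ^ 2 ≤ ⟪x, matSig H x⟫_ℝ := by
  classical
  obtain ⟨ε, hε, h⟩ := posSemidef_sub_smul_one hH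
  refine ⟨ε, hε, fun x => ?_⟩
  have := inner_matSig_nonneg h x
  rw [matSig_sub, matSig_smul, matSig_one, inner_sub_right, inner_smul_right,
    real_inner_self_eq_norm_sq] at this
  linarith

end MatrixOperators

/-! ### The dissipation matrix and the synthesis inequality -/

section MatrixFacts

theorem posDef_transpose_eq {ι : Type*} {R : Matrix ι ι ℝ} (hR : R.PosDef) : Rᵀ = R := by
  have h : R.IsSymm := by simpa using hR.1
  exact h

variable {ι κ : Type*} [Fintype ι] [Fintype κ]

theorem dotProduct_transpose_mul_mul_mulVec (A : Matrix κ ι ℝ) (R : Matrix κ κ ℝ) (z : ι → ℝ) :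
    z ⬝ᵥ (Aᵀ * R * A) *ᵥ z = (A *ᵥ z) ⬝ᵥ R *ᵥ (A *ᵥ z) := by
  rw [Matrix.mul_assoc, ← Matrix.mulVec_mulVec, ← Matrix.mulVec_mulVec, Matrix.mulVec_transpose,
    dotProduct_comm, ← Matrix.dotProduct_mulVec, dotProduct_comm]

theorem dotProduct_mulVec_comm {R : Matrix ι ι ℝ} (hR : Rᵀ = R) (v w : ι → ℝ) :
    v ⬝ᵥ R *ᵥ w = w ⬝ᵥ R *ᵥ v := by
  rw [Matrix.dotProduct_mulVec, ← Matrix.mulVec_transpose, hR, dotProduct_comm]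

theorem posDef_dotProduct_pos {R : Matrix ι ι ℝ} (hR : R.PosDef) {v : ι → ℝ} (hv : v ≠ 0) :
    0 < v ⬝ᵥ R *ᵥ v := by
  simpa using hR.dotProduct_mulVec_pos hv

theorem posSemidef_dotProduct_nonneg {R : Matrix ι ι ℝ} (hR : R.PosSemidef) (v : ι → ℝ) :
    0 ≤ v ⬝ᵥ R *ᵥ v := by
  simpa using hR.dotProduct_mulVec_nonneg v

theorem posDef_of_dotProduct_pos {R : Matrix ι ι ℝ} (hR : Rᵀ = R)
    (h : ∀ v : ι → ℝ, v ≠ 0 → 0 < v ⬝ᵥ R *ᵥ v) : R.PosDef :=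
  .of_dotProduct_mulVec_pos (by simpa [Matrix.IsHermitian] using hR)
    fun v hv => by simpa using h v hv

theorem posDef_mul_inv [DecidableEq ι] {R : Matrix ι ι ℝ} (hR : R.PosDef) : R * R⁻¹ = 1 :=
  Matrix.mul_nonsing_inv _ ((Matrix.isUnit_iff_isUnit_det _).1 hR.isUnit)

theorem posDef_inv_mul [DecidableEq ι] {R : Matrix ι ι ℝ} (hR : R.PosDef) : R⁻¹ * R = 1 :=
  Matrix.nonsing_inv_mul _ ((Matrix.isUnit_iff_isUnit_det _).1 hR.isUnit)

theorem posDef_fromBlocks_diag {R : Matrix ι ι ℝ} {Y : Matrix κ κ ℝ} (hR : R.PosDef)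
    (hY : Y.PosDef) : (Matrix.fromBlocks R 0 0 Y).PosDef := by
  refine posDef_of_dotProduct_pos ?_ fun v hv => ?_
  · simp [Matrix.fromBlocks_transpose, posDef_transpose_eq hR, posDef_transpose_eq hY]
  · obtain ⟨x, p, rfl⟩ : ∃ x p, v = Sum.elim x p := ⟨v ∘ Sum.inl, v ∘ Sum.inr, by simp⟩
    simp only [Matrix.fromBlocks_mulVec, Sum.elim_comp_inl, Sum.elim_comp_inr, Matrix.zero_mulVec,
      add_zero, zero_add, sumElim_dotProduct_sumElim]
    by_cases hx : x = 0
    · have hp : p ≠ 0 := by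
        rintro rfl
        exact hv (by ext i; cases i <;> simp [hx])
      have := posDef_dotProduct_pos hY hp
      simpa [hx] using this
    · have := posDef_dotProduct_pos hR hx
      have := posSemidef_dotProduct_nonneg hY.posSemidef p
      linarith

end MatrixFacts

namespace LFTSystem

variable {n np nd ne : Type} (G : LFTSystem n np nd ne)

/-- The map `(x, p) ↦ A x + B₀ p`. -/
def stateMatrix : Matrix n (n ⊕ np) ℝ := Matrix.fromCols G.A G.B₀

/-- The map `(x, p) ↦ C₀ x + D₀₀ p`. -/
def channelMatrix : Matrix np (n ⊕ np) ℝ := Matrix.fromCols G.C₀ G.D₀₀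

/-- The map `(x, p) ↦ C₁ x + D₁₀ p`. -/
def outputMatrix : Matrix ne (n ⊕ np) ℝ := Matrix.fromCols G.C₁ G.D₁₀

variable [Fintype n] [Fintype np] [Fintype ne]

/-- The matrix of the quadratic form
`|x|²_R + |p|²_Y - |A x + B₀ p|²_R - |C₀ x + D₀₀ p|²_Y - |C₁ x + D₁₀ p|²`. -/
def dissipationMatrix (R : Matrix n n ℝ) (Y : Matrix np np ℝ) :
    Matrix (n ⊕ np) (n ⊕ np) ℝ :=
  Matrix.fromBlocks R 0 0 Y - G.stateMatrixᵀ * R * G.stateMatrix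
    - G.channelMatrixᵀ * Y * G.channelMatrix - G.outputMatrixᵀ * G.outputMatrix

theorem dotProduct_dissipationMatrix_mulVec (R : Matrix n n ℝ) (Y : Matrix np np ℝ)
    (z : n ⊕ np → ℝ) :
    z ⬝ᵥ G.dissipationMatrix R Y *ᵥ z = z ⬝ᵥ Matrix.fromBlocks R 0 0 Y *ᵥ z
      - (G.stateMatrix *ᵥ z) ⬝ᵥ R *ᵥ (G.stateMatrix *ᵥ z)
      - (G.channelMatrix *ᵥ z) ⬝ᵥ Y *ᵥ (G.channelMatrix *ᵥ z)
      - (G.outputMatrix *ᵥ z) ⬝ᵥ (G.outputMatrix *ᵥ z) := by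
  classical
  have h := dotProduct_transpose_mul_mul_mulVec G.outputMatrix 1 z
  rw [Matrix.mul_one, Matrix.one_mulVec] at h
  rw [dissipationMatrix, Matrix.sub_mulVec, Matrix.sub_mulVec, Matrix.sub_mulVec,
    dotProduct_sub, dotProduct_sub, dotProduct_sub, dotProduct_transpose_mul_mul_mulVec,
    dotProduct_transpose_mul_mul_mulVec, h]

theorem transpose_dissipationMatrix {R : Matrix n n ℝ} {Y : Matrix np np ℝ} (hR : Rᵀ = R)
    (hY : Yᵀ = Y) : (G.dissipationMatrix R Y)ᵀ = G.dissipationMatrix R Y := by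
  simp [dissipationMatrix, Matrix.fromBlocks_transpose, Matrix.transpose_mul, hR, hY,
    Matrix.mul_assoc]

end LFTSystem

namespace LFTPlant

variable {n np nd ne nu : Type} [Fintype n] [Fintype np] [Fintype nu] [DecidableEq ne]
  (G : LFTPlant n np nd ne nu)

/-- Expanded once so that two test vectors can be inserted: one supported in the first block, for
the invertibility of `V`, and the one that produces the dissipation inequality. -/
theorem dotProduct_synthesisMatrix_mulVec [Fintype ne] (P : Matrix n n ℝ) {X : Matrix np np ℝ} (hX : Xᵀ = X)
    (M : Matrix nu n ℝ) (V : Matrix n n ℝ) (a c : n → ℝ) (b g : np → ℝ) (h : ne → ℝ) :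
    Sum.elim (Sum.elim a b) (Sum.elim c (Sum.elim g h)) ⬝ᵥ G.synthesisMatrix P X M V *ᵥ
        Sum.elim (Sum.elim a b) (Sum.elim c (Sum.elim g h))
      = 2 * (a ⬝ᵥ V *ᵥ a) - a ⬝ᵥ P *ᵥ a + b ⬝ᵥ X *ᵥ b
        + 2 * (c ⬝ᵥ ((G.A * V + G.B₂ * M) *ᵥ a + (G.B₀ * X) *ᵥ b))
        + 2 * (g ⬝ᵥ ((G.C₀ * V + G.D₀₂ * M) *ᵥ a + (G.D₀₀ * X) *ᵥ b))
        + 2 * (h ⬝ᵥ ((G.C₁ * V + G.D₁₂ * M) *ᵥ a + (G.D₁₀ * X) *ᵥ b))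
        + c ⬝ᵥ P *ᵥ c + g ⬝ᵥ X *ᵥ g + h ⬝ᵥ h := by
  have e1 : X * G.B₀ᵀ = (G.B₀ * X)ᵀ := by rw [Matrix.transpose_mul, hX]
  have e2 : X * G.D₀₀ᵀ = (G.D₀₀ * X)ᵀ := by rw [Matrix.transpose_mul, hX]
  have e3 : X * G.D₁₀ᵀ = (G.D₁₀ * X)ᵀ := by rw [Matrix.transpose_mul, hX]
  have key : ∀ {α β : Type} [Fintype α] [Fintype β] (K : Matrix α β ℝ) (v : α → ℝ) (w : β → ℝ),
      w ⬝ᵥ Kᵀ *ᵥ v = v ⬝ᵥ K *ᵥ w := fun K v w => by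
    rw [Matrix.mulVec_transpose, dotProduct_comm, ← Matrix.dotProduct_mulVec]
  rw [synthesisMatrix, e1, e2, e3]
  simp only [Matrix.fromBlocks_mulVec, Matrix.fromRows_mulVec, Matrix.fromCols_mulVec_sumElim,
    Sum.elim_comp_inl, Sum.elim_comp_inr, Sum.elim_add_add, sumElim_dotProduct_sumElim,
    Matrix.zero_mulVec, Matrix.one_mulVec, add_zero, zero_add, Matrix.sub_mulVec,
    dotProduct_add, dotProduct_sub, key]
  rw [Matrix.add_mulVec, dotProduct_add, key]
  ring

theorem posDef_of_synthesisMatrix_posDef {P : Matrix n n ℝ} {X : Matrix np np ℝ}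
    {M : Matrix nu n ℝ} {V : Matrix n n ℝ} (h : (G.synthesisMatrix P X M V).PosDef) : X.PosDef := by
  have := h.submatrix (e := fun i : np => Sum.inl (Sum.inr i)) fun i j hij => by simpa using hij
  exact this

/-- If `V a = 0`, the test vector `(a, 0, 0, 0, 0)` leaves only `-a ⬝ᵥ P *ᵥ a`, which cannot be
positive. -/
theorem isUnit_of_synthesisMatrix_posDef [Fintype ne] [DecidableEq n] {P : Matrix n n ℝ} (hP : P.PosDef) {X : Matrix np np ℝ}
    {M : Matrix nu n ℝ} {V : Matrix n n ℝ} (h : (G.synthesisMatrix P X M V).PosDef) :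
    IsUnit V := by
  have hX := posDef_transpose_eq (G.posDef_of_synthesisMatrix_posDef h)
  rw [← Matrix.mulVec_injective_iff_isUnit]
  refine (injective_iff_map_eq_zero V.mulVecLin).2 fun a ha => ?_
  by_contra ha0
  have h1 := posDef_dotProduct_pos h
    (v := Sum.elim (Sum.elim a 0) (Sum.elim 0 (Sum.elim 0 0)))
    fun h0 => ha0 (by ext i; simpa using congrFun h0 (Sum.inl (Sum.inl i)))
  rw [G.dotProduct_synthesisMatrix_mulVec P hX] at h1
  rw [Matrix.mulVecLin_apply] at ha
  have h2 := posDef_dotProduct_pos hP ha0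
  simp only [ha, Matrix.mulVec_zero, dotProduct_zero, zero_dotProduct] at h1
  linarith

/-- The synthesis inequality makes the closed loop strictly dissipative. -/
theorem dissipationMatrix_posDef [Fintype ne] [DecidableEq n] [DecidableEq np]
    {P : Matrix n n ℝ} (hP : P.PosDef) {X : Matrix np np ℝ}
    {M : Matrix nu n ℝ} {V : Matrix n n ℝ} (h : (G.synthesisMatrix P X M V).PosDef) :
    ((G.closedLoop (M * V⁻¹)).dissipationMatrix P⁻¹ X⁻¹).PosDef := by
  have hX := G.posDef_of_synthesisMatrix_posDef h
  have hXt := posDef_transpose_eq hX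
  have hV := G.isUnit_of_synthesisMatrix_posDef hP h
  have hVi : V * V⁻¹ = 1 := Matrix.mul_nonsing_inv _ ((Matrix.isUnit_iff_isUnit_det _).1 hV)
  refine posDef_of_dotProduct_pos (LFTSystem.transpose_dissipationMatrix _
    (posDef_transpose_eq hP.inv) (posDef_transpose_eq hX.inv)) fun z hz => ?_
  obtain ⟨x, p, rfl⟩ : ∃ x p, z = Sum.elim x p := ⟨z ∘ Sum.inl, z ∘ Sum.inr, by simp⟩
  rw [LFTSystem.dotProduct_dissipationMatrix_mulVec]
  simp only [LFTSystem.stateMatrix, LFTSystem.channelMatrix, LFTSystem.outputMatrix, closedLoop,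
    Matrix.fromCols_mulVec_sumElim, Matrix.fromBlocks_mulVec, Sum.elim_comp_inl,
    Sum.elim_comp_inr, Matrix.zero_mulVec, add_zero, zero_add, sumElim_dotProduct_sumElim]
  set y := (G.A + G.B₂ * (M * V⁻¹)) *ᵥ x + G.B₀ *ᵥ p with hy
  set q := (G.C₀ + G.D₀₂ * (M * V⁻¹)) *ᵥ x + G.D₀₀ *ᵥ p with hq
  set e := (G.C₁ + G.D₁₂ * (M * V⁻¹)) *ᵥ x + G.D₁₀ *ᵥ p with he
  set a := V⁻¹ *ᵥ x with ha
  set b := X⁻¹ *ᵥ p with hb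
  have hVa : V *ᵥ a = x := by rw [ha, Matrix.mulVec_mulVec, hVi, Matrix.one_mulVec]
  have hXb : X *ᵥ b = p := by
    rw [hb, Matrix.mulVec_mulVec, posDef_mul_inv hX, Matrix.one_mulVec]
  -- For fixed `(a, b)` the last three components minimise the form, so the test amounts to a Schur
  -- complement.
  have hab : Sum.elim (Sum.elim a b) (Sum.elim (-(P⁻¹ *ᵥ y)) (Sum.elim (-(X⁻¹ *ᵥ q)) (-e))) ≠ 0 := by
    intro h0
    have ha0 : a = 0 := by ext i; simpa using congrFun h0 (Sum.inl (Sum.inl i))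
    have hb0 : b = 0 := by ext i; simpa using congrFun h0 (Sum.inl (Sum.inr i))
    apply hz
    rw [← hVa, ← hXb, ha0, hb0, Matrix.mulVec_zero, Matrix.mulVec_zero]
    ext i; cases i <;> simp
  have key := posDef_dotProduct_pos h hab
  rw [G.dotProduct_synthesisMatrix_mulVec P hXt] at key
  have ey : (G.A * V + G.B₂ * M) *ᵥ a + (G.B₀ * X) *ᵥ b = y := by
    rw [hy, ← Matrix.mulVec_mulVec, hXb, ha, Matrix.mulVec_mulVec, Matrix.add_mul,
      Matrix.mul_assoc, hVi, Matrix.mul_one, Matrix.mul_assoc]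
  have eq : (G.C₀ * V + G.D₀₂ * M) *ᵥ a + (G.D₀₀ * X) *ᵥ b = q := by
    rw [hq, ← Matrix.mulVec_mulVec, hXb, ha, Matrix.mulVec_mulVec, Matrix.add_mul,
      Matrix.mul_assoc, hVi, Matrix.mul_one, Matrix.mul_assoc]
  have ee : (G.C₁ * V + G.D₁₂ * M) *ᵥ a + (G.D₁₀ * X) *ᵥ b = e := by
    rw [he, ← Matrix.mulVec_mulVec, hXb, ha, Matrix.mulVec_mulVec, Matrix.add_mul,
      Matrix.mul_assoc, hVi, Matrix.mul_one, Matrix.mul_assoc]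
  have hPy : P *ᵥ (P⁻¹ *ᵥ y) = y := by
    rw [Matrix.mulVec_mulVec, posDef_mul_inv hP, Matrix.one_mulVec]
  have hPx : P *ᵥ (P⁻¹ *ᵥ x) = x := by
    rw [Matrix.mulVec_mulVec, posDef_mul_inv hP, Matrix.one_mulVec]
  have hXq : X *ᵥ (X⁻¹ *ᵥ q) = q := by
    rw [Matrix.mulVec_mulVec, posDef_mul_inv hX, Matrix.one_mulVec]
  rw [ey, eq, ee, hVa, hXb] at key
  simp only [Matrix.mulVec_neg, neg_dotProduct, dotProduct_neg, neg_neg, hPy, hXq] at key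
  -- This square eliminates the slack variable `V`: it says `2 a·x - a·P a ≤ x·P⁻¹ x`, where `x = V
  -- a`.
  have hsq := posSemidef_dotProduct_nonneg hP.posSemidef (a - P⁻¹ *ᵥ x)
  simp only [Matrix.mulVec_sub, hPx, sub_dotProduct, dotProduct_sub] at hsq
  have e1 : (P⁻¹ *ᵥ x) ⬝ᵥ P *ᵥ a = a ⬝ᵥ x := by
    rw [dotProduct_mulVec_comm (posDef_transpose_eq hP), hPx]
  rw [e1, dotProduct_comm (P⁻¹ *ᵥ x) x] at hsq
  rw [dotProduct_comm (P⁻¹ *ᵥ y) y, dotProduct_comm (X⁻¹ *ᵥ q) q, dotProduct_comm b p] at key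
  linarith

end LFTPlant

/-! ### Scalings and structured uncertainties -/

section Uncertainty

variable {s f : ℕ} {m : Fin s → ℕ} {r : Fin f → ℕ}

/-- Needed because dissipation is weighted by `X⁻¹`, while the hypothesis concerns `X`. -/
theorem inv_mem_scalingSet {X : Matrix (Chan m r) (Chan m r) ℝ} (hX : X ∈ scalingSet m r) :
    X⁻¹ ∈ scalingSet m r := by
  obtain ⟨D, d, hD, hd, rfl⟩ := hX
  refine ⟨fun i => (D i)⁻¹, fun j => (d j)⁻¹, fun i => (hD i).inv, fun j => inv_pos.2 (hd j), ?_⟩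
  refine Matrix.inv_eq_right_inv ?_
  have h1 : (fun i => D i * (D i)⁻¹) = 1 := funext fun i => posDef_mul_inv (hD i)
  have h2 : (fun j => (d j • (1 : Matrix (Fin (r j)) (Fin (r j)) ℝ)) * ((d j)⁻¹ • 1)) = 1 :=
    funext fun j => by simp [smul_smul, (hd j).ne']
  rw [Matrix.fromBlocks_multiply, Matrix.mul_zero, Matrix.mul_zero, Matrix.zero_mul,
    Matrix.zero_mul, Matrix.mul_zero, Matrix.zero_mul, ← Matrix.blockDiagonal'_mul,
    ← Matrix.blockDiagonal'_mul, h1, h2]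
  simp

theorem exists_eq_transpose_mul_self {ι : Type*} [Fintype ι] [DecidableEq ι] {D : Matrix ι ι ℝ}
    (hD : D.PosSemidef) : ∃ U : Matrix ι ι ℝ, D = Uᵀ * U := by
  open scoped MatrixOrder in
  obtain ⟨U, hU⟩ := CStarAlgebra.nonneg_iff_eq_star_mul_self.1 (Matrix.nonneg_iff_posSemidef.2 hD)
  exact ⟨U, by simpa [Matrix.star_eq_conjTranspose] using hU⟩

theorem dotProduct_self_eq_sum_sq {ι : Type*} [Fintype ι] (v : ι → ℝ) :
    v ⬝ᵥ v = ∑ i, v i ^ 2 := by simp [dotProduct, sq]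

theorem dotProduct_blockDiagonal'_mulVec {o : Type*} [Fintype o] [DecidableEq o] {t : o → Type*}
    [∀ i, Fintype (t i)] (D : ∀ i, Matrix (t i) (t i) ℝ) (v : (Σ i, t i) → ℝ) :
    v ⬝ᵥ Matrix.blockDiagonal' D *ᵥ v
      = ∑ i, (fun a => v ⟨i, a⟩) ⬝ᵥ D i *ᵥ fun a => v ⟨i, a⟩ := by
  have h : ∀ i a, (Matrix.blockDiagonal' D *ᵥ v) ⟨i, a⟩ = (D i *ᵥ fun a => v ⟨i, a⟩) a := by
    intro i a
    simp only [Matrix.mulVec, dotProduct, Fintype.sum_sigma]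
    rw [Finset.sum_eq_single i]
    · simp [Matrix.blockDiagonal'_apply_eq]
    · intro j _ hj
      exact Finset.sum_eq_zero fun b _ => by
        rw [Matrix.blockDiagonal'_apply_ne _ _ _ hj.symm, zero_mul]
    · simp
  simp only [dotProduct, Fintype.sum_sigma, h]

theorem hasSum_norm_sq {E : Type*} [NormedAddCommGroup E] (x : lp (fun _ : ℕ => E) 2) :
    HasSum (fun k => ‖x k‖ ^ 2) (‖x‖ ^ 2) := by
  rw [norm_sq_eq_tsum]
  exact (summable_norm_sq x).hasSum

/-- Factoring `D i = (U i)ᵀ * U i` turns the weighted energy into unweighted energies of scalar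
signals and of full blocks, the objects to which the norm bounds on the uncertainty apply. -/
theorem inner_matSig_scaling {D : ∀ i : Fin s, Matrix (Fin (m i)) (Fin (m i)) ℝ} {d : Fin f → ℝ}
    {U : ∀ i : Fin s, Matrix (Fin (m i)) (Fin (m i)) ℝ} (hU : ∀ i, D i = (U i)ᵀ * U i)
    (x : Signal (Chan m r)) :
    ⟪x, matSig (Matrix.fromBlocks (Matrix.blockDiagonal' D) 0 0
        (Matrix.blockDiagonal' fun j => d j • (1 : Matrix (Fin (r j)) (Fin (r j)) ℝ))) x⟫_ℝ
      = ∑ i, ∑ b, ‖∑ a, U i b a • coord (Sum.inl ⟨i, a⟩) x‖ ^ 2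
        + ∑ j, d j * ‖block (fullBlock m r j) x‖ ^ 2 := by
  refine (lp.hasSum_inner x _).unique ?_
  have h := (hasSum_sum (s := Finset.univ) fun i _ => hasSum_sum (s := Finset.univ) fun b _ =>
    hasSum_norm_sq (∑ a, U i b a • coord (Sum.inl ⟨i, a⟩) x)).add
    (hasSum_sum (s := Finset.univ) fun j _ =>
      (hasSum_norm_sq (block (fullBlock m r j) x)).mul_left (d j))
  suffices hk : ∀ k, ⟪x k, matSig (Matrix.fromBlocks (Matrix.blockDiagonal' D) 0 0
      (Matrix.blockDiagonal' fun j => d j • (1 : Matrix (Fin (r j)) (Fin (r j)) ℝ))) x k⟫_ℝ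
      = ∑ i, ∑ b, ‖(∑ a, U i b a • coord (Sum.inl ⟨i, a⟩) x) k‖ ^ 2
        + ∑ j, d j * ‖block (fullBlock m r j) x k‖ ^ 2 by
    exact (funext hk ▸ h :)
  intro k
  rw [matSig_apply, EuclideanSpace.inner_eq_star_dotProduct, star_trivial, dotProduct_comm]
  generalize hv : (x k).ofLp = v
  obtain ⟨v₁, v₂, rfl⟩ : ∃ v₁ v₂, v = Sum.elim v₁ v₂ := ⟨v ∘ Sum.inl, v ∘ Sum.inr, by simp⟩
  simp only [Matrix.fromBlocks_mulVec, Sum.elim_comp_inl, Sum.elim_comp_inr, Matrix.zero_mulVec,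
      add_zero, zero_add, sumElim_dotProduct_sumElim, dotProduct_blockDiagonal'_mulVec]
  congr 1
  · refine Finset.sum_congr rfl fun i _ => ?_
    have h2 := dotProduct_transpose_mul_mul_mulVec (U i) 1 fun a => v₁ ⟨i, a⟩
    rw [Matrix.mul_one, Matrix.one_mulVec, ← hU, dotProduct_self_eq_sum_sq] at h2
    rw [h2]
    refine Finset.sum_congr rfl fun b _ => ?_
    have h3 : (∑ a, U i b a • coord (Sum.inl ⟨i, a⟩) x) k = ∑ a, U i b a * v₁ ⟨i, a⟩ := by
      rw [lp.coeFn_sum, Finset.sum_apply]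
      refine Finset.sum_congr rfl fun a _ => ?_
      have : coord (Sum.inl ⟨i, a⟩) x k = v₁ ⟨i, a⟩ := congrFun hv (Sum.inl ⟨i, a⟩)
      rw [lp.coeFn_smul, Pi.smul_apply, this, smul_eq_mul]
    rw [h3, Real.norm_eq_abs, sq_abs]
    rfl
  · refine Finset.sum_congr rfl fun j _ => ?_
    rw [Matrix.smul_mulVec, Matrix.one_mulVec, dotProduct_smul, dotProduct_self_eq_sum_sq,
      EuclideanSpace.norm_sq_eq, smul_eq_mul]
    congr 1
    refine Finset.sum_congr rfl fun a _ => ?_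
    have : block (fullBlock m r j) x k a = v₂ ⟨j, a⟩ := congrFun hv (Sum.inr ⟨j, a⟩)
    rw [this, Real.norm_eq_abs, sq_abs]

theorem norm_apply_sq_le {E F : Type*} [NormedAddCommGroup E] [NormedSpace ℝ E]
    [NormedAddCommGroup F] [NormedSpace ℝ F] {T : E →L[ℝ] F} (hT : ‖T‖ ≤ 1) (x : E) :
    ‖T x‖ ^ 2 ≤ ‖x‖ ^ 2 := by
  gcongr
  simpa using T.le_of_opNorm_le hT x

/-- Scalings do not increase under structured uncertainties. -/
theorem inner_scaling_uncertainty_le {Y : Matrix (Chan m r) (Chan m r) ℝ}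
    (hY : Y ∈ scalingSet m r) {Δ : Signal (Chan m r) →L[ℝ] Signal (Chan m r)}
    (hΔ : Δ ∈ uncertaintySet m r) (q : Signal (Chan m r)) :
    ⟪Δ q, matSig Y (Δ q)⟫_ℝ ≤ ⟪q, matSig Y q⟫_ℝ := by
  obtain ⟨D, d, hD, hd, rfl⟩ := hY
  obtain ⟨δ, Δf, hδ, hΔf, h⟩ := hΔ
  choose U hU using fun i => exists_eq_transpose_mul_self (hD i).posSemidef
  rw [inner_matSig_scaling hU, inner_matSig_scaling hU]
  refine add_le_add (Finset.sum_le_sum fun i _ => Finset.sum_le_sum fun b _ => ?_)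
    (Finset.sum_le_sum fun j _ => mul_le_mul_of_nonneg_left ?_ (hd j).le)
  -- The same scalar operator `δ i` acts on every coordinate of its block, so by linearity it
  -- commutes with `U i`.
  · have : ∑ a, U i b a • coord (Sum.inl ⟨i, a⟩) (Δ q)
        = δ i (∑ a, U i b a • coord (Sum.inl ⟨i, a⟩) q) := by
      simp only [map_sum, map_smul, (h q).1]
    rw [this]
    exact norm_apply_sq_le (hδ i) _
  · rw [(h q).2 j]
    exact norm_apply_sq_le (hΔf j) _

end Uncertainty

/-! ### Strict contractions in a weighted norm -/

section Contraction

variable {H : Type*} [NormedAddCommGroup H] [InnerProductSpace ℝ H] {W T : H →L[ℝ] H} {c ε : ℝ}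

/-- Nonnegativity of the `W`-energy of `x - T x` bounds `⟪T x, W x⟫` by the mean of the energies of
`x` and `T x`; half of the decrease `ε` survives. -/
theorem mul_norm_sq_le_inner_sub (hsymm : ∀ x y, ⟪W x, y⟫_ℝ = ⟪x, W y⟫_ℝ)
    (hpos : ∀ x, 0 ≤ ⟪x, W x⟫_ℝ)
    (hT : ∀ x, ⟪T x, W (T x)⟫_ℝ ≤ ⟪x, W x⟫_ℝ - ε * ‖x‖ ^ 2) (x : H) :
    ε / 2 * ‖x‖ ^ 2 ≤ ⟪W (x - T x), x⟫_ℝ := by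
  have h1 := hT x
  have h2 := hpos (x - T x)
  have h3 : ⟪W (x - T x), x⟫_ℝ = ⟪x, W x⟫_ℝ - ⟪T x, W x⟫_ℝ := by rw [hsymm, inner_sub_left]
  have h4 : ⟪x, W (T x)⟫_ℝ = ⟪T x, W x⟫_ℝ := by rw [← hsymm, real_inner_comm]
  simp only [map_sub, inner_sub_left, inner_sub_right, h4] at h2
  rw [h3]
  linarith

/-- Coercivity against Cauchy–Schwarz. The constant involves `W` and `ε` but not `T`, which later
gives uniformity over the uncertainties. -/
theorem norm_le_mul_norm_sub (hε : 0 < ε) (hsymm : ∀ x y, ⟪W x, y⟫_ℝ = ⟪x, W y⟫_ℝ)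
    (hpos : ∀ x, 0 ≤ ⟪x, W x⟫_ℝ)
    (hT : ∀ x, ⟪T x, W (T x)⟫_ℝ ≤ ⟪x, W x⟫_ℝ - ε * ‖x‖ ^ 2) (x : H) :
    ‖x‖ ≤ 2 * ‖W‖ / ε * ‖x - T x‖ := by
  have h1 := mul_norm_sq_le_inner_sub hsymm hpos hT x
  have h2 : ⟪W (x - T x), x⟫_ℝ ≤ ‖W‖ * ‖x - T x‖ * ‖x‖ :=
    (real_inner_le_norm _ _).trans (by gcongr; exact W.le_opNorm _)
  rcases (norm_nonneg x).eq_or_lt with h0 | h0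
  · rw [← h0]; positivity
  · have h3 : ε / 2 * ‖x‖ ≤ ‖W‖ * ‖x - T x‖ := by
      refine le_of_mul_le_mul_right ?_ h0
      calc ε / 2 * ‖x‖ * ‖x‖ = ε / 2 * ‖x‖ ^ 2 := by ring
        _ ≤ _ := h1.trans h2
    rw [div_mul_eq_mul_div, le_div_iff₀ hε]
    linarith

/-- The bilinear form `⟪W (x - T x), y⟫` is coercive, so Lax–Milgram solves `W (x - T x) = W y`, and
`W` is injective by its lower bound. -/
theorem exists_sub_eq [CompleteSpace H] (hc : 0 < c) (hε : 0 < ε)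
    (hsymm : ∀ x y, ⟪W x, y⟫_ℝ = ⟪x, W y⟫_ℝ) (hpos : ∀ x, c * ‖x‖ ^ 2 ≤ ⟪x, W x⟫_ℝ)
    (hT : ∀ x, ⟪T x, W (T x)⟫_ℝ ≤ ⟪x, W x⟫_ℝ - ε * ‖x‖ ^ 2) (y : H) :
    ∃ x, x - T x = y := by
  have hpos' : ∀ x, 0 ≤ ⟪x, W x⟫_ℝ := fun x => le_trans (by positivity) (hpos x)
  let S : H →L[ℝ] H := W ∘L (ContinuousLinearMap.id ℝ H - T)
  let B : H →L[ℝ] H →L[ℝ] ℝ := LinearMap.mkContinuous₂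
    (LinearMap.mk₂ ℝ (fun x y => ⟪S x, y⟫_ℝ) (by simp [inner_add_left])
      (by simp [real_inner_smul_left]) (by simp [inner_add_right])
      (by simp [real_inner_smul_right])) ‖S‖ fun x y =>
        (abs_real_inner_le_norm _ _).trans (by gcongr; exact S.le_opNorm _)
  have hB : IsCoercive B := ⟨ε / 2, by positivity, fun x => by
    have := mul_norm_sq_le_inner_sub hsymm hpos' hT x
    rw [mul_assoc, ← sq]
    exact this⟩
  obtain ⟨x, hx⟩ := hB.continuousLinearEquivOfBilin.surjective (W y)
  have hSx : S x = W y := by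
    refine ext_inner_right ℝ fun v => ?_
    rw [← hx, hB.continuousLinearEquivOfBilin_apply]
    rfl
  refine ⟨x, sub_eq_zero.1 ?_⟩
  have h0 : W (x - T x - y) = 0 := by
    rw [map_sub, sub_eq_zero]
    exact hSx
  have h1 := hpos (x - T x - y)
  rw [h0, inner_zero_right] at h1
  have h2 : ‖x - T x - y‖ ^ 2 ≤ 0 := by
    by_contra! h
    have := mul_pos hc h
    linarith
  exact norm_eq_zero.1 (by nlinarith [norm_nonneg (x - T x - y)])

end Contraction

/-! ### Pairs of signals -/

section PairSignals

variable {ι κ τ : Type} [Fintype ι] [Fintype κ] [Fintype τ] [DecidableEq ι] [DecidableEq κ]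

/-- The signal with the two components `x` and `p`. -/
def pairSig (x : Signal ι) (p : Signal κ) : Signal (ι ⊕ κ) :=
  matSig (Matrix.fromRows 1 0) x + matSig (Matrix.fromRows 0 1) p

/-- The first component of a pair of signals. -/
def fstSig : Signal (ι ⊕ κ) →L[ℝ] Signal ι := matSig (Matrix.fromCols 1 0)

/-- The second component of a pair of signals. -/
def sndSig : Signal (ι ⊕ κ) →L[ℝ] Signal κ := matSig (Matrix.fromCols 0 1)

theorem pairSig_apply (x : Signal ι) (p : Signal κ) (k : ℕ) :
    pairSig x p k = WithLp.toLp 2 (Sum.elim (x k).ofLp (p k).ofLp) := by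
  ext i
  cases i <;> simp [pairSig, Matrix.fromRows_mulVec]

theorem matSig_fromCols_pairSig (A : Matrix τ ι ℝ) (B : Matrix τ κ ℝ) (x : Signal ι)
    (p : Signal κ) : matSig (Matrix.fromCols A B) (pairSig x p) = matSig A x + matSig B p := by
  ext k : 2
  rw [matSig_apply, pairSig_apply]
  simp

theorem fstSig_pairSig (x : Signal ι) (p : Signal κ) : fstSig (pairSig x p) = x := by
  rw [fstSig, matSig_fromCols_pairSig, matSig_one]
  ext k : 2
  simp

theorem sndSig_pairSig (x : Signal ι) (p : Signal κ) : sndSig (pairSig x p) = p := by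
  rw [sndSig, matSig_fromCols_pairSig, matSig_one]
  ext k : 2
  simp

theorem pairSig_fstSig_sndSig (z : Signal (ι ⊕ κ)) : pairSig (fstSig z) (sndSig z) = z := by
  ext k i
  rw [pairSig_apply]
  cases i <;> simp [fstSig, sndSig, Matrix.fromCols_mulVec]

theorem pairSig_add_pairSig (x x' : Signal ι) (p p' : Signal κ) :
    pairSig x p + pairSig x' p' = pairSig (x + x') (p + p') := by
  simp only [pairSig, map_add]
  abel

theorem inner_pairSig (x x' : Signal ι) (p p' : Signal κ) :
    ⟪pairSig x p, pairSig x' p'⟫_ℝ = ⟪x, x'⟫_ℝ + ⟪p, p'⟫_ℝ := by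
  refine (lp.hasSum_inner _ _).unique ?_
  have h := (lp.hasSum_inner (𝕜 := ℝ) x x').add (lp.hasSum_inner (𝕜 := ℝ) p p')
  have hk : ∀ k, ⟪pairSig x p k, pairSig x' p' k⟫_ℝ = ⟪x k, x' k⟫_ℝ + ⟪p k, p' k⟫_ℝ := fun k => by
    rw [pairSig_apply, pairSig_apply]
    simp [EuclideanSpace.inner_eq_star_dotProduct]
  exact (funext hk ▸ h :)

theorem matSig_fromBlocks_pairSig (R : Matrix ι ι ℝ) (Y : Matrix κ κ ℝ) (x : Signal ι)
    (p : Signal κ) :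
    matSig (Matrix.fromBlocks R 0 0 Y) (pairSig x p) = pairSig (matSig R x) (matSig Y p) := by
  ext k i
  rw [matSig_apply, pairSig_apply, pairSig_apply]
  cases i <;> simp [Matrix.fromBlocks_mulVec]

theorem norm_pairSig_le (x : Signal ι) (p : Signal κ) : ‖pairSig x p‖ ≤ ‖x‖ + ‖p‖ := by
  refine abs_le_of_sq_le_sq' ?_ (by positivity) |>.2
  rw [← real_inner_self_eq_norm_sq, inner_pairSig, real_inner_self_eq_norm_sq,
    real_inner_self_eq_norm_sq]
  nlinarith [norm_nonneg x, norm_nonneg p]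

end PairSignals

/-! ### The closed loop as a fixed-point equation on `ℓ₂` -/

namespace LFTSystem

variable {n np nd ne : Type} [Fintype n] [Fintype np]
  (G : LFTSystem n np nd ne)

theorem inner_dissipationMatrix [Fintype ne] (R : Matrix n n ℝ) (Y : Matrix np np ℝ) (z : Signal (n ⊕ np)) :
    ⟪z, matSig (G.dissipationMatrix R Y) z⟫_ℝ = ⟪z, matSig (Matrix.fromBlocks R 0 0 Y) z⟫_ℝ
      - ⟪matSig G.stateMatrix z, matSig R (matSig G.stateMatrix z)⟫_ℝ
      - ⟪matSig G.channelMatrix z, matSig Y (matSig G.channelMatrix z)⟫_ℝ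
      - ‖matSig G.outputMatrix z‖ ^ 2 := by
  rw [dissipationMatrix, matSig_sub, matSig_sub, matSig_sub, inner_sub_right, inner_sub_right,
    inner_sub_right, ← real_inner_self_eq_norm_sq, inner_matSig, inner_matSig, inner_matSig]
  simp only [matSig_matSig, Matrix.mul_assoc]

variable [DecidableEq n] [DecidableEq np]

/-- The closed-loop equations in terms of `z = (x, p)` read `z = loopMap z + (input)`. -/
def loopMap (Δ : Signal np →L[ℝ] Signal np) : Signal (n ⊕ np) →L[ℝ] Signal (n ⊕ np) :=
  matSig (Matrix.fromRows 1 0) ∘L rightShift.toContinuousLinearMap ∘L matSig G.stateMatrix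
    + matSig (Matrix.fromRows 0 1) ∘L Δ ∘L matSig G.channelMatrix

theorem loopMap_apply (Δ : Signal np →L[ℝ] Signal np) (z : Signal (n ⊕ np)) :
    G.loopMap Δ z
      = pairSig (rightShift (matSig G.stateMatrix z)) (Δ (matSig G.channelMatrix z)) := rfl

/-- The input of the closed-loop equations. -/
def loopInput [Fintype nd] (x₀ : EuclideanSpace ℝ n) (d : Signal nd) (w : Signal np) : Signal (n ⊕ np) :=
  pairSig (rightShift (matSig G.B₁ d) + lp.single 2 0 x₀) w

/-- The right shift has value zero at time 0, so the initial state enters as an impulse there and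
the recursion becomes one identity between signals. -/
theorem equations_iff [Fintype nd] [Fintype ne] {x₀ : EuclideanSpace ℝ n} {d : Signal nd} {x : Signal n} {p q : Signal np}
    {e : Signal ne} : G.Equations x₀ d x p q e ↔
      x = rightShift (matSig G.stateMatrix (pairSig x p)) +
          (rightShift (matSig G.B₁ d) + lp.single 2 0 x₀) ∧
      q = matSig G.channelMatrix (pairSig x p) ∧ e = matSig G.outputMatrix (pairSig x p) := by
  rw [stateMatrix, channelMatrix, outputMatrix, matSig_fromCols_pairSig, matSig_fromCols_pairSig,
    matSig_fromCols_pairSig]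
  constructor
  · rintro ⟨h0, h⟩
    refine ⟨?_, ?_, ?_⟩
    · ext k : 2
      cases k with
      | zero => simp [h0]
      | succ k =>
        apply (WithLp.equiv 2 _).injective
        simpa using (h k).1
    · ext k : 2
      apply (WithLp.equiv 2 _).injective
      simpa using (h k).2.1
    · ext k : 2
      apply (WithLp.equiv 2 _).injective
      simpa using (h k).2.2
  · rintro ⟨h1, h2, h3⟩
    refine ⟨?_, fun k => ⟨?_, ?_, ?_⟩⟩
    · rw [h1]; simp
    · have := congrArg (fun y : Signal n => (y (k + 1)).ofLp) h1
      simpa using this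
    · have := congrArg (fun y : Signal np => (y k).ofLp) h2
      simpa using this
    · have := congrArg (fun y : Signal ne => (y k).ofLp) h3
      simpa using this

theorem isTrajectory_iff [Fintype nd] [Fintype ne] {Δ : Signal np →L[ℝ] Signal np} {x₀ : EuclideanSpace ℝ n}
    {d : Signal nd} {w : Signal np} {x : Signal n} {p q : Signal np} {e : Signal ne} :
    G.IsTrajectory Δ x₀ d w x p q e ↔
      pairSig x p - G.loopMap Δ (pairSig x p) = G.loopInput x₀ d w ∧
      q = matSig G.channelMatrix (pairSig x p) ∧ e = matSig G.outputMatrix (pairSig x p) := by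
  rw [IsTrajectory, equations_iff, sub_eq_iff_eq_add', loopMap_apply, loopInput,
    pairSig_add_pairSig]
  constructor
  · rintro ⟨⟨h1, h2, h3⟩, h4⟩
    rw [← h1, ← h2, ← h4]
    exact ⟨rfl, rfl, h3⟩
  · rintro ⟨h1, h2, h3⟩
    refine ⟨⟨?_, h2, h3⟩, ?_⟩
    · have := congrArg fstSig h1
      rwa [fstSig_pairSig, fstSig_pairSig] at this
    · have := congrArg sndSig h1
      rw [sndSig_pairSig, sndSig_pairSig] at this
      rw [h2]
      exact this

variable {R : Matrix n n ℝ} {Y : Matrix np np ℝ} {U : Set (Signal np →L[ℝ] Signal np)}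

/-- The right shift is an isometry commuting with `R`, and `Δ` does not increase the `Y`-energy, so
the loop loses at least what the dissipation matrix prescribes. The margin `ε` comes from that
matrix alone. -/
theorem inner_loopMap_le [Fintype ne] (hH : (G.dissipationMatrix R Y).PosDef) :
    ∃ ε : ℝ, 0 < ε ∧ ∀ Δ : Signal np →L[ℝ] Signal np,
      (∀ q, ⟪Δ q, matSig Y (Δ q)⟫_ℝ ≤ ⟪q, matSig Y q⟫_ℝ) → ∀ z,
      ⟪G.loopMap Δ z, matSig (Matrix.fromBlocks R 0 0 Y) (G.loopMap Δ z)⟫_ℝ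
        ≤ ⟪z, matSig (Matrix.fromBlocks R 0 0 Y) z⟫_ℝ - ε * ‖z‖ ^ 2 := by
  obtain ⟨ε, hε, h⟩ := exists_pos_mul_norm_sq_le hH
  refine ⟨ε, hε, fun Δ hΔ z => ?_⟩
  have h1 := h z
  have h2 := hΔ (matSig G.channelMatrix z)
  rw [inner_dissipationMatrix] at h1
  have h3 : 0 ≤ ‖matSig G.outputMatrix z‖ ^ 2 := by positivity
  have h4 : ⟪rightShift (matSig G.stateMatrix z), matSig R (rightShift (matSig G.stateMatrix z))⟫_ℝ
      = ⟪matSig G.stateMatrix z, matSig R (matSig G.stateMatrix z)⟫_ℝ := by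
    rw [matSig_rightShift, LinearIsometry.inner_map_map]
  rw [loopMap_apply, matSig_fromBlocks_pairSig, inner_pairSig, h4]
  linarith

theorem inner_matSig_symm {ι : Type} [Fintype ι] {W : Matrix ι ι ℝ} (hW : Wᵀ = W)
    (x y : Signal ι) : ⟪matSig W x, y⟫_ℝ = ⟪x, matSig W y⟫_ℝ := by rw [inner_matSig, hW]

/-- The closed loop is uniquely solvable, with a bound uniform over the uncertainties. -/
theorem exists_bound_loopMap [Fintype ne] (hR : R.PosDef) (hY : Y.PosDef)
    (hH : (G.dissipationMatrix R Y).PosDef)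
    (hU : ∀ Δ ∈ U, ∀ q, ⟪Δ q, matSig Y (Δ q)⟫_ℝ ≤ ⟪q, matSig Y q⟫_ℝ) :
    ∃ C : ℝ, 0 ≤ C ∧ ∀ Δ ∈ U, (∀ z, ‖z‖ ≤ C * ‖z - G.loopMap Δ z‖) ∧
      ∀ v, ∃ z, z - G.loopMap Δ z = v := by
  obtain ⟨ε, hε, h⟩ := G.inner_loopMap_le hH
  have hW := posDef_fromBlocks_diag hR hY
  obtain ⟨c, hc, hc'⟩ := exists_pos_mul_norm_sq_le hW
  have hs := inner_matSig_symm (posDef_transpose_eq hW)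
  exact ⟨2 * ‖matSig (Matrix.fromBlocks R 0 0 Y)‖ / ε, by positivity, fun Δ hΔ =>
    ⟨norm_le_mul_norm_sub hε hs (inner_matSig_nonneg hW.posSemidef) (h Δ (hU Δ hΔ)),
      exists_sub_eq hc hε hs hc' (h Δ (hU Δ hΔ))⟩⟩

theorem norm_loopInput_le [Fintype nd] (x₀ : EuclideanSpace ℝ n) (d : Signal nd)
    (w : Signal np) :
    ‖G.loopInput x₀ d w‖ ≤ ‖matSig G.B₁‖ * ‖d‖ + ‖x₀‖ + ‖w‖ := by
  refine (norm_pairSig_le _ _).trans (add_le_add_left ((norm_add_le _ _).trans ?_) _)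
  rw [LinearIsometry.norm_map, lp.norm_single (by norm_num)]
  exact add_le_add_left ((matSig G.B₁).le_opNorm d) _

/-- Existence, uniqueness and boundedness of the square-summable trajectories. -/
theorem exists_unique_trajectory_bound [Fintype nd] [Fintype ne] (hR : R.PosDef)
    (hY : Y.PosDef)
    (hH : (G.dissipationMatrix R Y).PosDef)
    (hU : ∀ Δ ∈ U, ∀ q, ⟪Δ q, matSig Y (Δ q)⟫_ℝ ≤ ⟪q, matSig Y q⟫_ℝ) :
    ∃ C : ℝ, ∀ Δ ∈ U, ∀ (x₀ : EuclideanSpace ℝ n) (d : Signal nd) (w : Signal np),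
    ∃ (x : Signal n) (p q : Signal np) (e : Signal ne),
      G.IsTrajectory Δ x₀ d w x p q e ∧
      (∀ x' p' q' e', G.IsTrajectory Δ x₀ d w x' p' q' e' →
        x' = x ∧ p' = p ∧ q' = q ∧ e' = e) ∧
      ‖x‖ + ‖p‖ + ‖q‖ + ‖e‖ ≤ C * (‖x₀‖ + ‖d‖ + ‖w‖) := by
  obtain ⟨C, hC0, hC⟩ := G.exists_bound_loopMap hR hY hH hU
  let K : ℝ := ‖(fstSig : Signal (n ⊕ np) →L[ℝ] Signal n)‖
    + ‖(sndSig : Signal (n ⊕ np) →L[ℝ] Signal np)‖ + ‖matSig G.channelMatrix‖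
    + ‖matSig G.outputMatrix‖
  refine ⟨K * C * (‖matSig G.B₁‖ + 1), fun Δ hΔ x₀ d w => ?_⟩
  obtain ⟨hb, hs⟩ := hC Δ hΔ
  obtain ⟨z, hz⟩ := hs (G.loopInput x₀ d w)
  refine ⟨fstSig z, sndSig z, matSig G.channelMatrix z, matSig G.outputMatrix z, ?_, ?_, ?_⟩
  · rw [isTrajectory_iff, pairSig_fstSig_sndSig]
    exact ⟨hz, rfl, rfl⟩
  · intro x' p' q' e' h
    obtain ⟨h1, h2, h3⟩ := G.isTrajectory_iff.1 h
    have hzz : pairSig x' p' = z := by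
      have := hb (pairSig x' p' - z)
      rw [map_sub, sub_sub_sub_comm, h1, hz, sub_self, norm_zero, mul_zero] at this
      exact sub_eq_zero.1 (norm_le_zero_iff.1 this)
    rw [hzz] at h2 h3
    exact ⟨by rw [← hzz, fstSig_pairSig], by rw [← hzz, sndSig_pairSig], h2, h3⟩
  · have h1 : ‖fstSig z‖ + ‖sndSig z‖ + ‖matSig G.channelMatrix z‖ + ‖matSig G.outputMatrix z‖
        ≤ K * ‖z‖ := by
      simp only [K, add_mul]
      gcongr <;> exact ContinuousLinearMap.le_opNorm _ _
    have h2 : ‖z‖ ≤ C * ((‖matSig G.B₁‖ + 1) * (‖x₀‖ + ‖d‖ + ‖w‖)) := by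
      refine (hb z).trans (mul_le_mul_of_nonneg_left ?_ hC0)
      rw [hz]
      refine (G.norm_loopInput_le x₀ d w).trans ?_
      have := mul_nonneg (norm_nonneg (matSig G.B₁)) (norm_nonneg x₀)
      have := mul_nonneg (norm_nonneg (matSig G.B₁)) (norm_nonneg w)
      nlinarith [norm_nonneg d]
    calc _ ≤ K * ‖z‖ := h1
      _ ≤ K * (C * ((‖matSig G.B₁‖ + 1) * (‖x₀‖ + ‖d‖ + ‖w‖))) := by
        gcongr
      _ = _ := by ring

end LFTSystem

/-! ### Truncations and causal uncertainties -/

section Truncation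

variable {ι : Type} [Fintype ι]

/-- The signal that agrees with the sequence `f` before time `K` and vanishes from then on. -/
def truncSig (K : ℕ) (f : ℕ → EuclideanSpace ℝ ι) : Signal ι :=
  ∑ l ∈ Finset.range K, lp.single 2 l (f l)

theorem truncSig_apply (K : ℕ) (f : ℕ → EuclideanSpace ℝ ι) (k : ℕ) :
    truncSig K f k = if k < K then f k else 0 := by
  rw [truncSig, lp.coeFn_sum, Finset.sum_apply]
  simp only [lp.single_apply, Pi.single_apply, Finset.sum_ite_eq, Finset.mem_range]

theorem inner_matSig_truncSig (K : ℕ) (f : ℕ → EuclideanSpace ℝ ι) (Y : Matrix ι ι ℝ) :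
    ⟪truncSig K f, matSig Y (truncSig K f)⟫_ℝ
      = ∑ l ∈ Finset.range K, (f l).ofLp ⬝ᵥ Y *ᵥ (f l).ofLp := by
  rw [lp.inner_eq_tsum, tsum_eq_sum (s := Finset.range K)]
  · refine Finset.sum_congr rfl fun l hl => ?_
    rw [matSig_apply, truncSig_apply, if_pos (Finset.mem_range.1 hl),
      EuclideanSpace.inner_eq_star_dotProduct, star_trivial, dotProduct_comm]
  · intro l hl
    rw [truncSig_apply, if_neg (by simpa using hl), inner_zero_left]

theorem sum_dotProduct_le_inner_matSig (K : ℕ) {Y : Matrix ι ι ℝ} (hY : Y.PosSemidef)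
    (x : Signal ι) :
    ∑ l ∈ Finset.range K, (x l).ofLp ⬝ᵥ Y *ᵥ (x l).ofLp ≤ ⟪x, matSig Y x⟫_ℝ := by
  have h : ∀ l, ⟪x l, matSig Y x l⟫_ℝ = (x l).ofLp ⬝ᵥ Y *ᵥ (x l).ofLp := fun l => by
    rw [matSig_apply, EuclideanSpace.inner_eq_star_dotProduct, star_trivial, dotProduct_comm]
  have hs := summable_inner_apply x (matSig Y x)
  rw [lp.inner_eq_tsum]
  simp only [h] at hs ⊢
  exact hs.sum_le_tsum _ fun l _ => posSemidef_dotProduct_nonneg hY _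

end Truncation

namespace LFTSystem

variable {n np nd ne : Type} [Fintype n] [Fintype np] (G : LFTSystem n np nd ne)
  {R : Matrix n n ℝ} {Y : Matrix np np ℝ}

/-- A trajectory without input that is compatible with a contractive causal uncertainty
vanishes. -/
theorem eq_zero_of_dissipative [Fintype ne] (hR : R.PosDef)
    (hH : (G.dissipationMatrix R Y).PosDef) {x : ℕ → n → ℝ} {p q : ℕ → np → ℝ}
    (h0 : x 0 = 0) (hx : ∀ k, x (k + 1) = G.A *ᵥ x k + G.B₀ *ᵥ p k)
    (hq : ∀ k, q k = G.C₀ *ᵥ x k + G.D₀₀ *ᵥ p k)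
    (hpq : ∀ K, ∑ l ∈ Finset.range K, p l ⬝ᵥ Y *ᵥ p l ≤ ∑ l ∈ Finset.range K, q l ⬝ᵥ Y *ᵥ q l)
    (k : ℕ) : x k = 0 ∧ p k = 0 := by
  let z : ℕ → n ⊕ np → ℝ := fun k => Sum.elim (x k) (p k)
  have hstep : ∀ k, x (k + 1) ⬝ᵥ R *ᵥ x (k + 1) + q k ⬝ᵥ Y *ᵥ q k
      + z k ⬝ᵥ G.dissipationMatrix R Y *ᵥ z k ≤ x k ⬝ᵥ R *ᵥ x k + p k ⬝ᵥ Y *ᵥ p k := fun k => by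
    have h := G.dotProduct_dissipationMatrix_mulVec R Y (z k)
    simp only [z, stateMatrix, channelMatrix, Matrix.fromCols_mulVec_sumElim, ← hx, ← hq,
      Matrix.fromBlocks_mulVec, Sum.elim_comp_inl, Sum.elim_comp_inr, Matrix.zero_mulVec,
      add_zero, zero_add, sumElim_dotProduct_sumElim] at h ⊢
    have h2 : 0 ≤ (G.outputMatrix *ᵥ Sum.elim (x k) (p k)) ⬝ᵥ
        (G.outputMatrix *ᵥ Sum.elim (x k) (p k)) := by
      rw [dotProduct_self_eq_sum_sq]; positivity
    linarith
  -- The storage `x·R x` telescopes, starting from zero; the hypothesis on partial sums of `p` and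
  -- `q` then leaves no room for a nonzero `z`.
  have hsum : ∀ K, x K ⬝ᵥ R *ᵥ x K + ∑ l ∈ Finset.range K, q l ⬝ᵥ Y *ᵥ q l
      + ∑ l ∈ Finset.range K, z l ⬝ᵥ G.dissipationMatrix R Y *ᵥ z l
      ≤ ∑ l ∈ Finset.range K, p l ⬝ᵥ Y *ᵥ p l := fun K => by
    induction K with
    | zero => simp [h0]
    | succ K ih =>
      simp only [Finset.sum_range_succ]
      linarith [hstep K]
  have hz : z k = 0 := by
    by_contra hne
    have h1 := hsum (k + 1)
    have h2 := hpq (k + 1)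
    have h3 := posSemidef_dotProduct_nonneg hR.posSemidef (x (k + 1))
    have h4 := posDef_dotProduct_pos hH hne
    have h5 : z k ⬝ᵥ G.dissipationMatrix R Y *ᵥ z k
        ≤ ∑ l ∈ Finset.range (k + 1), z l ⬝ᵥ G.dissipationMatrix R Y *ᵥ z l :=
      Finset.single_le_sum (f := fun l => z l ⬝ᵥ G.dissipationMatrix R Y *ᵥ z l)
        (fun l _ => posSemidef_dotProduct_nonneg hH.posSemidef _) (Finset.self_mem_range_succ k)
    linarith
  exact ⟨funext fun i => congrFun hz (Sum.inl i), funext fun i => congrFun hz (Sum.inr i)⟩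

/-- For a causal contractive uncertainty, an arbitrary solution coincides with the
square-summable one. -/
theorem eq_trajectory_of_causal [Fintype nd] [Fintype ne] (hR : R.PosDef) (hY : Y.PosDef)
    (hH : (G.dissipationMatrix R Y).PosDef) {Δ : Signal np →L[ℝ] Signal np}
    (hΔ : ∀ q, ⟪Δ q, matSig Y (Δ q)⟫_ℝ ≤ ⟪q, matSig Y q⟫_ℝ) (hc : Causal Δ)
    {x₀ : EuclideanSpace ℝ n} {d : Signal nd} {w : Signal np} {x' : Signal n} {p' q' : Signal np}
    {e' : Signal ne} (h' : G.IsTrajectory Δ x₀ d w x' p' q' e')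
    {x : ℕ → EuclideanSpace ℝ n} {p q : ℕ → EuclideanSpace ℝ np} {e : ℕ → EuclideanSpace ℝ ne}
    (h : G.Equations x₀ d x p q e)
    (hp : ∀ (k : ℕ) (q' : Signal np), (∀ l ≤ k, q' l = q l) → p k = Δ q' k + w k) :
    x = x' ∧ p = p' ∧ q = q' ∧ e = e' := by
  obtain ⟨⟨h0', hk'⟩, hp'⟩ := h'
  obtain ⟨h0, hk⟩ := h
  -- The sequence `q` need not be square-summable, so `Δ` can only be fed truncations; causality
  -- makes values from time `K` on irrelevant before `K`.
  have hδp : ∀ K, ∀ k < K, p k - p' k = Δ (truncSig K fun l => q l - q' l) k := fun K k hkK => by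
    have h1 := hp k (truncSig K q) fun l hl => by
      rw [truncSig_apply, if_pos (hl.trans_lt hkK)]
    have h2 : p' k = Δ q' k + w k := by
      conv_lhs => rw [hp']
      rfl
    have h3 : Δ (truncSig K fun l => q l - q' l) k = Δ (truncSig K q - q') k :=
      hc k _ _ fun l hl => by
        rw [truncSig_apply, if_pos (hl.trans_lt hkK), lp.coeFn_sub, Pi.sub_apply, truncSig_apply,
          if_pos (hl.trans_lt hkK)]
    rw [h1, h2, h3, map_sub, lp.coeFn_sub, Pi.sub_apply]
    abel
  have hzero := G.eq_zero_of_dissipative hR hH (x := fun k => (x k).ofLp - (x' k).ofLp)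
    (p := fun k => (p k).ofLp - (p' k).ofLp) (q := fun k => (q k).ofLp - (q' k).ofLp)
    (by simp [h0, h0'])
    (fun k => by
      rw [(hk k).1, (hk' k).1, Matrix.mulVec_sub, Matrix.mulVec_sub]
      abel)
    (fun k => by
      rw [(hk k).2.1, (hk' k).2.1, Matrix.mulVec_sub, Matrix.mulVec_sub]
      abel)
    (fun K => by
      have h1 := sum_dotProduct_le_inner_matSig K hY.posSemidef
        (Δ (truncSig K fun l => q l - q' l))
      have h2 := h1.trans (hΔ _)
      rw [inner_matSig_truncSig] at h2
      refine (Finset.sum_congr rfl fun l hl => ?_).trans_le h2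
      rw [← hδp K l (Finset.mem_range.1 hl)]
      rfl)
  have ex : ∀ k, (x k).ofLp = (x' k).ofLp := fun k => sub_eq_zero.1 (hzero k).1
  have ep : ∀ k, (p k).ofLp = (p' k).ofLp := fun k => sub_eq_zero.1 (hzero k).2
  refine ⟨funext fun k => (WithLp.equiv 2 _).injective (ex k),
    funext fun k => (WithLp.equiv 2 _).injective (ep k),
    funext fun k => (WithLp.equiv 2 _).injective ?_,
    funext fun k => (WithLp.equiv 2 _).injective ?_⟩
  · exact (hk k).2.1.trans (by rw [ex, ep, ← (hk' k).2.1]; rfl)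
  · exact (hk k).2.2.trans (by rw [ex, ep, ← (hk' k).2.2]; rfl)

variable [Fintype nd] [Fintype ne] [DecidableEq n] [DecidableEq np]
  {U : Set (Signal np →L[ℝ] Signal np)}

/-- Strict dissipativity with a scaling that is not increased by the uncertainties implies robust
stability. -/
theorem robustlyStable_of_dissipative (hR : R.PosDef) (hY : Y.PosDef)
    (hH : (G.dissipationMatrix R Y).PosDef)
    (hU : ∀ Δ ∈ U, ∀ q, ⟪Δ q, matSig Y (Δ q)⟫_ℝ ≤ ⟪q, matSig Y q⟫_ℝ) :
    G.RobustlyStable U := by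
  obtain ⟨C, hC⟩ := G.exists_unique_trajectory_bound hR hY hH hU
  refine ⟨⟨C, hC⟩, fun Δ hΔ hc x₀ d w x p q e h hp => ?_⟩
  obtain ⟨x', p', q', e', h', -⟩ := hC Δ hΔ x₀ d w
  obtain ⟨rfl, rfl, rfl, rfl⟩ := G.eq_trajectory_of_causal hR hY hH (hU Δ hΔ) hc h' h hp
  exact ⟨lp.memℓp _, lp.memℓp _, lp.memℓp _, lp.memℓp _⟩

/-- The disturbance-to-output maps exist and the trajectories are uniformly bounded. -/
theorem exists_isDisturbanceMap (hR : R.PosDef) (hY : Y.PosDef)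
    (hH : (G.dissipationMatrix R Y).PosDef)
    (hU : ∀ Δ ∈ U, ∀ q, ⟪Δ q, matSig Y (Δ q)⟫_ℝ ≤ ⟪q, matSig Y q⟫_ℝ) :
    ∃ (C : ℝ) (T : (Signal np →L[ℝ] Signal np) → (Signal nd →L[ℝ] Signal ne)), 0 ≤ C ∧
      (∀ Δ ∈ U, G.IsDisturbanceMap Δ (T Δ)) ∧
      ∀ Δ ∈ U, ∀ d, ∃ (x : Signal n) (p q : Signal np),
        G.IsTrajectory Δ 0 d 0 x p q (T Δ d) ∧ ‖x‖ ≤ C * ‖d‖ := by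
  obtain ⟨C, hC⟩ := G.exists_unique_trajectory_bound hR hY hH hU
  have hT : ∀ Δ : Signal np →L[ℝ] Signal np, ∃ T : Signal nd →L[ℝ] Signal ne, Δ ∈ U → ∀ d,
      ∃ (x : Signal n) (p q : Signal np),
        G.IsTrajectory Δ 0 d 0 x p q (T d) ∧ ‖x‖ ≤ C * ‖d‖ ∧
        ∀ x' p' q' e', G.IsTrajectory Δ 0 d 0 x' p' q' e' → e' = T d := by
    intro Δ
    by_cases hΔ : Δ ∈ U
    swap
    -- Outside `U` nothing is required, so zero serves as a default map.
    · exact ⟨0, fun h => absurd h hΔ⟩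
    choose x p q e h hu hb using fun d => hC Δ hΔ 0 d 0
    -- Sums of trajectories are trajectories, so uniqueness forces additivity; homogeneity follows
    -- in the same way.
    have hadd : ∀ d d', e (d + d') = e d + e d' := fun d d' => by
      obtain ⟨h1, -, h3⟩ := G.isTrajectory_iff.1 (h d)
      obtain ⟨h1', -, h3'⟩ := G.isTrajectory_iff.1 (h d')
      refine (hu (d + d') (x d + x d') (p d + p d') _ _
        (G.isTrajectory_iff.2 ⟨?_, rfl, ?_⟩)).2.2.2.symm
      · rw [← pairSig_add_pairSig, map_add, add_sub_add_comm, h1, h1', loopInput, loopInput,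
          loopInput, pairSig_add_pairSig]
        simp
      · rw [← pairSig_add_pairSig, map_add, ← h3, ← h3']
    have hsmul : ∀ (c : ℝ) d, e (c • d) = c • e d := fun c d => by
      obtain ⟨h1, -, h3⟩ := G.isTrajectory_iff.1 (h d)
      have hps : ∀ (x : Signal n) (p : Signal np), pairSig (c • x) (c • p) = c • pairSig x p :=
        fun x p => by simp only [pairSig, map_smul, smul_add]
      refine (hu (c • d) (c • x d) (c • p d) _ _
        (G.isTrajectory_iff.2 ⟨?_, rfl, ?_⟩)).2.2.2.symm
      · rw [hps, map_smul, ← smul_sub, h1, loopInput, loopInput, ← hps]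
        simp
      · rw [hps, map_smul, ← h3]
    have hbd : ∀ d, ‖x d‖ + ‖p d‖ + ‖q d‖ + ‖e d‖ ≤ C * ‖d‖ := fun d => by simpa using hb d
    refine ⟨LinearMap.mkContinuous { toFun := e, map_add' := hadd, map_smul' := hsmul } C
      fun d => ?_, fun _ d => ⟨x d, p d, q d, h d, ?_, fun x' p' q' e' h' =>
        (hu d x' p' q' e' h').2.2.2⟩⟩
    · show ‖e d‖ ≤ C * ‖d‖
      linarith [hbd d, norm_nonneg (x d), norm_nonneg (p d), norm_nonneg (q d)]
    · linarith [hbd d, norm_nonneg (e d), norm_nonneg (p d), norm_nonneg (q d)]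
  choose T hT using hT
  refine ⟨max C 0, T, le_max_right _ _, fun Δ hΔ d e => ?_, fun Δ hΔ d => ?_⟩
  · obtain ⟨x, p, q, h, -, hu⟩ := hT Δ hΔ d
    constructor
    · rintro ⟨x', p', q', h'⟩
      exact hu x' p' q' e h'
    · rintro rfl
      exact ⟨x, p, q, h⟩
  · obtain ⟨x, p, q, h, hx, -⟩ := hT Δ hΔ d
    exact ⟨x, p, q, h, hx.trans (by gcongr; exact le_max_left _ _)⟩

end LFTSystem

/-! ### Autocorrelations of white-noise signals -/

section FourierTransform

theorem iterate_rightShift_apply {E : Type*} [NormedAddCommGroup E] [NormedSpace ℝ E] (i : ℕ)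
    (x : lp (fun _ : ℕ => E) 2) (k : ℕ) :
    (rightShift^[i] x) k = if i ≤ k then x (k - i) else 0 := by
  induction i generalizing k with
  | zero => simp
  | succ i ih =>
    rw [Function.iterate_succ_apply']
    cases k with
    | zero => simp
    | succ k => simp [ih]

/-- The transform uses `e^{-iωk}`, so the value at time `k` is the coefficient of index `-k`, and
only indices `n ≤ 0` occur. -/
theorem fourierCoeff_fourierTransform (f : ScalarSignal) (n : ℤ) :
    fourierCoeff (fourierTransform f : AddCircle (2 * Real.pi) → ℂ) n
      = if n ≤ 0 then (f n.natAbs : ℂ) else 0 := by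
  rw [← fourierBasis_repr, HilbertBasis.repr_apply_apply]
  refine ((hasSum_fourierTransform f).mapL (innerSL ℂ (fourierBasis n))).unique ?_
  have hterm : ∀ k : ℕ, innerSL ℂ (fourierBasis (T := 2 * Real.pi) n)
      ((f k : ℂ) • fourierLp 2 (-(k : ℤ))) = if n = -(k : ℤ) then (f k : ℂ) else 0 := fun k => by
    rw [innerSL_apply_apply, inner_smul_right, coe_fourierBasis,
      orthonormal_iff_ite.1 orthonormal_fourier]
    simp
  simp only [hterm]
  split_ifs with hn
  · have h := hasSum_single (f := fun k : ℕ => if n = -(k : ℤ) then (f k : ℂ) else 0) n.natAbs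
      fun k hk => if_neg (by omega)
    rwa [if_pos (by omega)] at h
  · have h0 : (fun k : ℕ => if n = -(k : ℤ) then (f k : ℂ) else 0) = fun _ => 0 :=
      funext fun k => if_neg (by omega)
    rw [h0]
    exact hasSum_zero

theorem inner_fourierTransform (f g : ScalarSignal) :
    ⟪fourierTransform f, fourierTransform g⟫_ℂ = (⟪f, g⟫_ℝ : ℂ) := by
  have h1 := (hasSum_fourierTransform g).mapL (innerSL ℂ (fourierTransform f))
  have h2 : ∀ k : ℕ, innerSL ℂ (fourierTransform f) ((g k : ℂ) • fourierLp 2 (-(k : ℤ)))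
      = ((⟪f k, g k⟫_ℝ : ℝ) : ℂ) := fun k => by
    have h3 := fourierCoeff_fourierTransform f (-(k : ℤ))
    rw [← fourierBasis_repr, HilbertBasis.repr_apply_apply, coe_fourierBasis] at h3
    rw [innerSL_apply_apply, inner_smul_right, ← inner_conj_symm, h3]
    simp
  simp only [h2] at h1
  exact h1.unique (Complex.hasSum_ofReal.2 (lp.hasSum_inner (𝕜 := ℝ) f g))

/-- Multiplication by a character shifts Fourier coefficients; both sides have the same
coefficients, hence agree almost everywhere. -/
theorem fourierTransform_iterate_rightShift (i : ℕ) (f : ScalarSignal) :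
    (fourierTransform (rightShift^[i] f) : AddCircle (2 * Real.pi) → ℂ)
      =ᵐ[AddCircle.haarAddCircle] fun t => fourier (-(i : ℤ)) t * fourierTransform f t := by
  have hmem : MemLp (fun t => fourier (-(i : ℤ)) t * fourierTransform f t) 2
      (AddCircle.haarAddCircle (T := 2 * Real.pi)) :=
    (Lp.memLp (fourierTransform f)).of_le
      ((fourier (-(i : ℤ))).continuous.aestronglyMeasurable.mul (Lp.aestronglyMeasurable _))
      (ae_of_all _ fun t => by rw [norm_mul, fourier_apply, Circle.norm_coe, one_mul])
  suffices h : fourierTransform (rightShift^[i] f) = hmem.toLp by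
    rw [h]; exact hmem.coeFn_toLp
  apply fourierBasis.repr.injective
  ext n
  rw [fourierBasis_repr, fourierBasis_repr, fourierCoeff_fourierTransform,
    fourierCoeff_congr_ae hmem.coeFn_toLp]
  have h : fourierCoeff (fun t => fourier (-(i : ℤ)) t * fourierTransform f t) n
      = fourierCoeff (fourierTransform f : AddCircle (2 * Real.pi) → ℂ) (n + i) := by
    rw [fourierCoeff, fourierCoeff]
    congr 1
    funext t
    rw [smul_eq_mul, smul_eq_mul, ← mul_assoc, ← fourier_add, neg_add]
  rw [h, fourierCoeff_fourierTransform, iterate_rightShift_apply]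
  by_cases hn : n + i ≤ 0
  · rw [if_pos (by omega), if_pos hn, if_pos (by omega)]
    have : n.natAbs - i = (n + i).natAbs := by omega
    rw [this]
  · rw [if_neg hn]
    split_ifs <;> first | rfl | omega

/-- Correlations of delayed signals as integrals of the cross-spectrum. -/
theorem inner_iterate_rightShift_eq_integral (i j : ℕ) (f g : ScalarSignal) :
    ((⟪rightShift^[i] f, rightShift^[j] g⟫_ℝ : ℝ) : ℂ)
      = ∫ ω in (0 : ℝ)..2 * Real.pi, fourier ((i : ℤ) - j) (ω : AddCircle (2 * Real.pi)) *
        ((fourierTransform g : AddCircle (2 * Real.pi) → ℂ) (ω : AddCircle (2 * Real.pi)) *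
        conj ((fourierTransform f : AddCircle (2 * Real.pi) → ℂ)
          (ω : AddCircle (2 * Real.pi))) / (2 * Real.pi)) := by
  have h := fourierCoeff_eq_intervalIntegral (T := 2 * Real.pi)
    (fun t => fourierTransform g t * conj (fourierTransform f t)) ((j : ℤ) - i) 0
  rw [zero_add, neg_sub] at h
  have h2 : ((⟪rightShift^[i] f, rightShift^[j] g⟫_ℝ : ℝ) : ℂ)
      = fourierCoeff (fun t : AddCircle (2 * Real.pi) =>
        fourierTransform g t * conj (fourierTransform f t)) ((j : ℤ) - i) := by
    rw [← inner_fourierTransform, L2.inner_def, fourierCoeff]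
    refine integral_congr_ae ?_
    filter_upwards [fourierTransform_iterate_rightShift i f,
      fourierTransform_iterate_rightShift j g] with t h1 h2
    rw [h1, h2, RCLike.inner_apply, map_mul, ← fourier_neg, neg_neg, smul_eq_mul, neg_sub,
      sub_eq_add_neg, fourier_add]
    ring
  rw [h2, h, ← intervalIntegral.integral_smul]
  refine intervalIntegral.integral_congr fun ω _ => ?_
  simp only [smul_eq_mul, Complex.real_smul]
  push_cast
  ring

/-- A product of two `L²` functions is integrable; the rest transfers this from the circle to the
interval. -/
theorem intervalIntegrable_crossSpectrum (f g : ScalarSignal) :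
    IntervalIntegrable (fun ω : ℝ =>
      (fourierTransform g : AddCircle (2 * Real.pi) → ℂ) (ω : AddCircle (2 * Real.pi)) *
        conj ((fourierTransform f : AddCircle (2 * Real.pi) → ℂ)
          (ω : AddCircle (2 * Real.pi))) / (2 * Real.pi)) volume 0 (2 * Real.pi) := by
  refine IntervalIntegrable.div_const ?_ _
  have h : Integrable (fun t : AddCircle (2 * Real.pi) =>
      fourierTransform g t * conj (fourierTransform f t)) volume := by
    rw [AddCircle.volume_eq_smul_haarAddCircle]
    refine Integrable.smul_measure ?_ ENNReal.ofReal_ne_top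
    refine (L2.integrable_inner (𝕜 := ℂ) (fourierTransform f) (fourierTransform g)).congr
      (ae_of_all _ fun t => ?_)
    exact RCLike.inner_apply _ _
  have h2 := (AddCircle.measurePreserving_mk (2 * Real.pi) 0).integrable_comp_of_integrable h
  rw [zero_add] at h2
  rw [intervalIntegrable_iff_integrableOn_Ioc_of_le (by positivity)]
  exact h2

end FourierTransform

/-! ### Integration by parts with a merely integrable factor -/

section PartialIntegration

/-- If all primitives of `ψ` are bounded by `η`, its integrals against a `C¹` function are small. -/
theorem norm_integral_mul_le_of_primitive_le {T η : ℝ} (hT : 0 ≤ T) {ψ g g' : ℝ → ℂ} {M : ℝ}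
    (hψ : IntervalIntegrable ψ volume 0 T) (hg : ∀ t, HasDerivAt g (g' t) t) (hg' : Continuous g')
    (hM : ∀ t, ‖g' t‖ ≤ M) (hη : ∀ s ∈ Set.Icc 0 T, ‖∫ t in (0 : ℝ)..s, ψ t‖ ≤ η) :
    ‖∫ t in (0 : ℝ)..T, g t * ψ t‖ ≤ (‖g T‖ + T * M) * η := by
  have hη0 : 0 ≤ η := by simpa using hη 0 ⟨le_rfl, hT⟩
  have hM0 : 0 ≤ M := (norm_nonneg _).trans (hM 0)
  set μ := (volume : Measure ℝ).restrict (Set.Ioc 0 T)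
  have hψ' : Integrable ψ μ := (intervalIntegrable_iff_integrableOn_Ioc_of_le hT).1 hψ
  have hgi : Integrable g' μ := (intervalIntegrable_iff_integrableOn_Ioc_of_le hT).1
    (hg'.intervalIntegrable _ _)
  -- Fubini for `ψ t * g' s` on the triangle `t < s` replaces classical integration by parts:
  -- integrating first in `s` gives `g T - g t`, first in `t` the primitive of `ψ`.
  let S : Set (ℝ × ℝ) := {p | p.1 < p.2}
  have hS : MeasurableSet S := measurableSet_lt measurable_fst measurable_snd
  let F : ℝ → ℝ → ℂ := fun t s => S.indicator (fun p => ψ p.1 * g' p.2) (t, s)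
  have hF : Integrable (Function.uncurry F) (μ.prod μ) := (hψ'.mul_prod hgi).indicator hS
  have hswap := integral_integral_swap hF
  have hleft : ∀ t ∈ Set.Ioc 0 T, ∫ s, F t s ∂μ = ψ t * (g T - g t) := fun t ht => by
    have h1 : ∀ s, F t s = (Set.Ioi t).indicator (fun s => ψ t * g' s) s := fun s => by
      simp only [F, S, Set.indicator, Set.mem_ofPred_eq, Set.mem_Ioi]
    have h2 : Set.Ioi t ∩ Set.Ioc 0 T = Set.Ioc t T := by
      ext s; simp only [Set.mem_inter_iff, Set.mem_Ioi, Set.mem_Ioc]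
      exact ⟨fun h => ⟨h.1, h.2.2⟩, fun h => ⟨h.1, ht.1.trans h.1, h.2⟩⟩
    simp only [h1]
    rw [integral_indicator measurableSet_Ioi, Measure.restrict_restrict measurableSet_Ioi, h2,
      ← intervalIntegral.integral_of_le ht.2, intervalIntegral.integral_const_mul,
      intervalIntegral.integral_eq_sub_of_hasDerivAt (fun s _ => hg s)
        (hg'.intervalIntegrable _ _)]
  have hright : ∀ s ∈ Set.Ioc 0 T, ‖∫ t, F t s ∂μ‖ ≤ M * η := fun s hs => by
    have h1 : ∀ t, F t s = (Set.Iio s).indicator (fun t => ψ t * g' s) t := fun t => by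
      simp only [F, S, Set.indicator, Set.mem_ofPred_eq, Set.mem_Iio]
    have h2 : Set.Iio s ∩ Set.Ioc 0 T = Set.Ioo 0 s := by
      ext t; simp only [Set.mem_inter_iff, Set.mem_Iio, Set.mem_Ioc, Set.mem_Ioo]
      exact ⟨fun h => ⟨h.2.1, h.1⟩, fun h => ⟨h.2, h.1, h.2.le.trans hs.2⟩⟩
    simp only [h1]
    rw [integral_indicator measurableSet_Iio, Measure.restrict_restrict measurableSet_Iio, h2,
      ← integral_Ioc_eq_integral_Ioo, ← intervalIntegral.integral_of_le hs.1.le,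
      intervalIntegral.integral_mul_const, norm_mul, mul_comm]
    exact mul_le_mul (hM s) (hη s ⟨hs.1.le, hs.2⟩) (norm_nonneg _) hM0
  have hL : ∫ t, ∫ s, F t s ∂μ ∂μ = g T * (∫ t in (0 : ℝ)..T, ψ t)
      - ∫ t in (0 : ℝ)..T, g t * ψ t := by
    rw [setIntegral_congr_fun measurableSet_Ioc hleft, ← intervalIntegral.integral_of_le hT,
      ← intervalIntegral.integral_const_mul, ← intervalIntegral.integral_sub]
    · exact intervalIntegral.integral_congr fun t _ => by ring
    · exact hψ.const_mul _
    · exact hψ.continuousOn_mul (continuous_iff_continuousAt.2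
        fun t => (hg t).continuousAt).continuousOn
  have hR : ‖∫ s, ∫ t, F t s ∂μ ∂μ‖ ≤ T * (M * η) := by
    have := norm_setIntegral_le_of_norm_le_const (μ := volume) (s := Set.Ioc 0 T)
      measure_Ioc_lt_top hright
    simpa [hT, mul_comm] using this
  have heq : ∫ t in (0 : ℝ)..T, g t * ψ t
      = g T * (∫ t in (0 : ℝ)..T, ψ t) - ∫ s, ∫ t, F t s ∂μ ∂μ := by
    rw [← hswap, hL]; ring
  rw [heq]
  refine (norm_sub_le _ _).trans ?_
  rw [norm_mul]
  have := mul_le_mul_of_nonneg_left (hη T ⟨hT, le_rfl⟩) (norm_nonneg (g T))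
  linarith

end PartialIntegration

/-! ### Correlations of delayed white noise -/

section WhiteNoise

theorem integral_fourier (n : ℤ) :
    ∫ ω in (0 : ℝ)..2 * Real.pi, fourier n (ω : AddCircle (2 * Real.pi))
      = if n = 0 then (2 * Real.pi : ℂ) else 0 := by
  split_ifs with hn
  · subst hn
    simp
  · have hc : Continuous fun ω : ℝ => fourier n (ω : AddCircle (2 * Real.pi)) :=
      (fourier n).continuous.comp (AddCircle.continuous_mk' _)
    have h := intervalIntegral.integral_eq_sub_of_hasDerivAt (a := 0) (b := 2 * Real.pi)
      (fun x _ => hasDerivAt_fourier (2 * Real.pi) n x)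
      ((hc.intervalIntegrable _ _).const_mul _)
    rw [intervalIntegral.integral_const_mul, AddCircle.coe_period, AddCircle.coe_zero,
      sub_self] at h
    refine (mul_eq_zero.1 h).resolve_left ?_
    have hpi : (Real.pi : ℂ) ≠ 0 := by exact_mod_cast Real.pi_ne_zero
    have hn' : (n : ℂ) ≠ 0 := by exact_mod_cast hn
    push_cast
    exact div_ne_zero (mul_ne_zero (mul_ne_zero (mul_ne_zero two_ne_zero hpi) Complex.I_ne_zero)
      hn') (mul_ne_zero two_ne_zero hpi)

variable {p : ℕ} {η : ℝ} {f : Signal (Fin p)}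

/-- The autocorrelations of a signal in `whiteNoiseSet p η` are close to those of white noise. -/
theorem abs_inner_coord_sub_le (hf : f ∈ whiteNoiseSet p η) (i j : ℕ) (a b : Fin p) :
    |⟪rightShift^[i] (coord a f), rightShift^[j] (coord b f)⟫_ℝ
      - (if i = j ∧ a = b then ‖f‖ ^ 2 / p else 0)|
      ≤ (1 + 2 * Real.pi * (i + j)) * η := by
  -- The constant cross-spectral density of ideal white noise.
  set c : ℂ := if a = b then ((‖f‖ ^ 2 / (2 * p * Real.pi) : ℝ) : ℂ) else 0 with hc
  set φ : ℝ → ℂ := fun ω =>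
    (fourierTransform (coord b f) : AddCircle (2 * Real.pi) → ℂ) (ω : AddCircle (2 * Real.pi)) *
      conj ((fourierTransform (coord a f) : AddCircle (2 * Real.pi) → ℂ)
        (ω : AddCircle (2 * Real.pi))) / (2 * Real.pi) with hφ
  have hφi : IntervalIntegrable φ volume 0 (2 * Real.pi) := intervalIntegrable_crossSpectrum _ _
  have hgc : Continuous fun ω : ℝ => fourier ((i : ℤ) - j) (ω : AddCircle (2 * Real.pi)) :=
    (fourier _).continuous.comp (AddCircle.continuous_mk' _)
  have hg1 : ∀ ω : ℝ, ‖fourier ((i : ℤ) - j) (ω : AddCircle (2 * Real.pi))‖ = 1 := fun ω => by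
    rw [fourier_apply, Circle.norm_coe]
  -- The character of index `i - j` has derivative of modulus `|i - j|`, bounded crudely by `M = i +
  -- j`.
  have key := norm_integral_mul_le_of_primitive_le (T := 2 * Real.pi) (η := η)
    (ψ := fun ω => φ ω - c) (M := (i : ℝ) + j) Real.two_pi_pos.le
    (hφi.sub (intervalIntegrable_const))
    (fun t => hasDerivAt_fourier (2 * Real.pi) ((i : ℤ) - j) t) (hgc.const_mul _)
    (fun t => by
      have hpi : (Real.pi : ℂ) ≠ 0 := by exact_mod_cast Real.pi_ne_zero
      have e : 2 * (Real.pi : ℂ) * Complex.I * (((i : ℤ) - j : ℤ) : ℂ) / ((2 * Real.pi : ℝ) : ℂ)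
          = Complex.I * (((i : ℝ) - j : ℝ) : ℂ) := by
        push_cast
        field_simp
      rw [norm_mul, hg1, mul_one, e, norm_mul, Complex.norm_I, one_mul, Complex.norm_real]
      refine (norm_sub_le _ _).trans (le_of_eq ?_)
      rw [Real.norm_natCast, Real.norm_natCast])
    (fun s hs => by
      -- The inner product of coordinates `a` and `b` integrates the second transform times the
      -- conjugate of the first, hence the entry `(b, a)`.
      have h := (hf s hs b a).le
      have e : ∫ t in (0 : ℝ)..s, (φ t - c) = (cumulativeSpectrum f s -
          ((s * ‖f‖ ^ 2 / (2 * p * Real.pi) : ℝ) : ℂ) • (1 : Matrix (Fin p) (Fin p) ℂ)) b a := by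
        rw [intervalIntegral.integral_sub (hφi.mono_set (by
          rw [Set.uIcc_of_le hs.1, Set.uIcc_of_le Real.two_pi_pos.le]
          exact Set.Icc_subset_Icc_right hs.2)) intervalIntegrable_const,
          intervalIntegral.integral_const, Matrix.sub_apply, Matrix.smul_apply, Matrix.one_apply]
        congr 1
        rw [hc, sub_zero]
        by_cases hab : a = b
        · rw [if_pos hab, if_pos hab.symm, Complex.real_smul, smul_eq_mul]
          push_cast
          ring
        · rw [if_neg hab, if_neg fun h => hab h.symm, smul_zero, smul_zero]
      rw [e]
      exact h)
  have e1 : ∫ ω in (0 : ℝ)..2 * Real.pi,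
      fourier ((i : ℤ) - j) (ω : AddCircle (2 * Real.pi)) * (φ ω - c)
      = ((⟪rightShift^[i] (coord a f), rightShift^[j] (coord b f)⟫_ℝ
        - (if i = j ∧ a = b then ‖f‖ ^ 2 / p else 0) : ℝ) : ℂ) := by
    simp only [mul_sub]
    rw [intervalIntegral.integral_sub (hφi.continuousOn_mul hgc.continuousOn)
      ((hgc.intervalIntegrable _ _).mul_const c), Complex.ofReal_sub,
      inner_iterate_rightShift_eq_integral, intervalIntegral.integral_mul_const, integral_fourier]
    congr 1
    have hpi : (Real.pi : ℂ) ≠ 0 := by exact_mod_cast Real.pi_ne_zero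
    have hp : (p : ℂ) ≠ 0 := by
      have := a.pos
      exact_mod_cast this.ne'
    by_cases hij : i = j
    · by_cases hab : a = b
      · rw [if_pos (by omega), hc, if_pos hab, if_pos ⟨hij, hab⟩]
        push_cast
        field_simp
      · rw [hc, if_neg hab, if_neg fun h : i = j ∧ a = b => hab h.2]
        simp
    · rw [if_neg (by omega), if_neg fun h => hij h.1]
      simp
  rw [e1, Complex.norm_real, hg1] at key
  exact key

section Coord

variable {ι κ : Type} [Fintype ι] [Fintype κ]

theorem coord_apply (c : ι) (x : Signal ι) (k : ℕ) : coord c x k = x k c := rfl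

theorem coord_iterate_rightShift (c : ι) (x : Signal ι) (i : ℕ) :
    coord c (rightShift^[i] x) = rightShift^[i] (coord c x) := by
  ext k
  rw [coord_apply, iterate_rightShift_apply, iterate_rightShift_apply]
  split_ifs <;> rfl

theorem inner_eq_sum_coord (x y : Signal ι) : ⟪x, y⟫_ℝ = ∑ c, ⟪coord c x, coord c y⟫_ℝ := by
  refine (lp.hasSum_inner (𝕜 := ℝ) x y).unique ?_
  have h := hasSum_sum (s := Finset.univ) fun c _ =>
    lp.hasSum_inner (𝕜 := ℝ) (coord c x) (coord c y)
  have hk : ∀ k, ⟪x k, y k⟫_ℝ = ∑ c, ⟪coord c x k, coord c y k⟫_ℝ := fun k => PiLp.inner_apply _ _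
  exact (funext hk ▸ h :)

theorem coord_matSig (A : Matrix κ ι ℝ) (x : Signal ι) (c : κ) :
    coord c (matSig A x) = ∑ a, A c a • coord a x := by
  ext k
  rw [lp.coeFn_sum, Finset.sum_apply]
  rfl

end Coord

theorem inner_iterate_rightShift_matSig_le (hf : f ∈ whiteNoiseSet p η)
    (U : Matrix (Fin p) (Fin p) ℝ) (i j : ℕ) :
    ⟪rightShift^[i] f, matSig U (rightShift^[j] f)⟫_ℝ
      ≤ (if i = j then U.trace * (‖f‖ ^ 2 / p) else 0)
        + (∑ a, ∑ b, |U a b|) * (1 + 2 * Real.pi * (i + j)) * η := by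
  have e : ⟪rightShift^[i] f, matSig U (rightShift^[j] f)⟫_ℝ
      = ∑ a, ∑ b, U a b * ⟪rightShift^[i] (coord a f), rightShift^[j] (coord b f)⟫_ℝ := by
    simp only [inner_eq_sum_coord, coord_matSig, coord_iterate_rightShift, inner_sum,
      real_inner_smul_right]
  have e2 : (if i = j then U.trace * (‖f‖ ^ 2 / p) else 0)
      = ∑ a, ∑ b, U a b * (if i = j ∧ a = b then ‖f‖ ^ 2 / p else 0) := by
    by_cases hij : i = j
    · simp [hij, Matrix.trace, Finset.sum_mul]
    · simp [hij]
  rw [e, e2, Finset.sum_mul, Finset.sum_mul, ← Finset.sum_add_distrib]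
  refine Finset.sum_le_sum fun a _ => ?_
  rw [Finset.sum_mul, Finset.sum_mul, ← Finset.sum_add_distrib]
  refine Finset.sum_le_sum fun b _ => ?_
  have h := abs_inner_coord_sub_le hf i j a b
  rw [← sub_le_iff_le_add', ← mul_sub, mul_assoc]
  refine (le_abs_self _).trans ?_
  rw [abs_mul]
  exact mul_le_mul_of_nonneg_left h (abs_nonneg _)

end WhiteNoise

/-! ### The anticausal filter for the worst-case output energy -/

section FilterMatrices

/-- With `D = P' - P`, the difference is the congruence of `D + D P⁻¹ D` by `P'⁻¹`, which keeps
strict positivity. -/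
theorem posDef_inv_sub_inv {n : Type*} [Fintype n] [DecidableEq n] {P P' : Matrix n n ℝ}
    (hP : P.PosDef) (hP' : P'.PosDef) (hD : (P' - P).PosDef) : (P⁻¹ - P'⁻¹).PosDef := by
  have h1 := posDef_mul_inv hP
  have h1' := posDef_inv_mul hP
  have h2 := posDef_mul_inv hP'
  have h2' := posDef_inv_mul hP'
  have e : P⁻¹ - P'⁻¹ = P'⁻¹ᴴ * ((P' - P) + (P' - P)ᴴ * P⁻¹ * (P' - P)) * P'⁻¹ := by
    rw [hP'.inv.1, hD.1]
    have e1 : (P' - P) + (P' - P) * P⁻¹ * (P' - P) = P' * P⁻¹ * P' - P' := by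
      rw [Matrix.sub_mul, h1, Matrix.sub_mul, Matrix.one_mul, Matrix.mul_sub,
        Matrix.mul_assoc P' P⁻¹ P, h1', Matrix.mul_one]
      abel
    rw [e1, Matrix.mul_sub, Matrix.sub_mul, Matrix.mul_assoc, Matrix.mul_assoc, h2, Matrix.mul_one,
      ← Matrix.mul_assoc, h2', Matrix.one_mul, Matrix.one_mul]
  rw [e]
  refine (hD.add_posSemidef (hP.inv.posSemidef.conjTranspose_mul_mul_same _))
    |>.conjTranspose_mul_mul_same ?_
  exact Matrix.mulVec_injective_iff_isUnit.2 hP'.inv.isUnit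

/-- This identity turns the energy matrix `R Θ R + R` of the filter, for `R = P'⁻¹`, into the matrix
of the Schur complement in the coupling condition. It follows from `Θ = P' (P' - P)⁻¹ P' - P'`. -/
theorem inv_mul_inv_sub_inv_mul_inv {n : Type*} [Fintype n] [DecidableEq n] {P P' : Matrix n n ℝ}
    (hP : P.PosDef) (hP' : P'.PosDef) (hD : (P' - P).PosDef) :
    P'⁻¹ * (P⁻¹ - P'⁻¹)⁻¹ * P'⁻¹ + P'⁻¹ = (P' - P)⁻¹ := by
  have h1' := posDef_inv_mul hP
  have h2 := posDef_mul_inv hP'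
  have h2' := posDef_inv_mul hP'
  have h3 := posDef_mul_inv hD
  have h4 : P⁻¹ * P' * (P' - P)⁻¹ = P⁻¹ + (P' - P)⁻¹ := by
    have : P' = (P' - P) + P := by abel
    conv_lhs => rw [this, Matrix.mul_add, Matrix.add_mul, Matrix.mul_assoc, ← this, h3, h1']
    rw [Matrix.mul_one, Matrix.one_mul]
  have e : (P⁻¹ - P'⁻¹)⁻¹ = P' * (P' - P)⁻¹ * P' - P' := by
    refine Matrix.inv_eq_right_inv ?_
    rw [Matrix.sub_mul, Matrix.mul_sub, Matrix.mul_sub, ← Matrix.mul_assoc, ← Matrix.mul_assoc,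
      ← Matrix.mul_assoc P'⁻¹, ← Matrix.mul_assoc P'⁻¹, h2', Matrix.one_mul, h4, Matrix.add_mul]
    abel
  rw [e, Matrix.mul_sub, Matrix.sub_mul, h2', Matrix.one_mul, Matrix.mul_assoc P' _ P',
    ← Matrix.mul_assoc, h2', Matrix.one_mul, Matrix.mul_assoc, h2, Matrix.mul_one]
  abel

theorem exists_mul_dotProduct_le {ι : Type} [Fintype ι] {H : Matrix ι ι ℝ} (hH : H.PosDef)
    (S : Matrix ι ι ℝ) : ∃ ε : ℝ, 0 < ε ∧ ∀ v : ι → ℝ, ε * (v ⬝ᵥ S *ᵥ v) ≤ v ⬝ᵥ H *ᵥ v := by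
  obtain ⟨c, hc, h⟩ := exists_pos_mul_dotProduct_le hH
  refine ⟨c / (‖matCLM S‖ + 1), by positivity, fun v => ?_⟩
  have h1 : v ⬝ᵥ S *ᵥ v ≤ (‖matCLM S‖ + 1) * (v ⬝ᵥ v) := by
    have e1 : v ⬝ᵥ S *ᵥ v = ⟪matCLM S (WithLp.toLp 2 v), WithLp.toLp 2 v⟫_ℝ := by
      rw [matCLM_apply, EuclideanSpace.inner_toLp_toLp, star_trivial]
    have e2 : v ⬝ᵥ v = ‖(WithLp.toLp 2 v : EuclideanSpace ℝ ι)‖ ^ 2 := by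
      rw [← real_inner_self_eq_norm_sq, EuclideanSpace.inner_toLp_toLp, star_trivial]
    rw [e1, e2]
    have h2 := (matCLM S).le_opNorm (WithLp.toLp 2 v)
    have h3 := real_inner_le_norm (matCLM S (WithLp.toLp 2 v)) (WithLp.toLp 2 v)
    nlinarith [norm_nonneg (WithLp.toLp 2 v : EuclideanSpace ℝ ι)]
  calc c / (‖matCLM S‖ + 1) * (v ⬝ᵥ S *ᵥ v)
      ≤ c / (‖matCLM S‖ + 1) * ((‖matCLM S‖ + 1) * (v ⬝ᵥ v)) := by gcongr
    _ = c * (v ⬝ᵥ v) := by field_simp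
    _ ≤ _ := h v

theorem trace_transpose_mul_mul {ι κ : Type*} [Fintype ι] [Fintype κ] (K : Matrix κ ι ℝ)
    (H : Matrix κ κ ℝ) : (Kᵀ * H * K).trace = ∑ a, K.col a ⬝ᵥ H *ᵥ K.col a := by
  simp only [Matrix.trace, Matrix.diag_apply]
  refine Finset.sum_congr rfl fun a _ => ?_
  rw [Matrix.mul_assoc, Matrix.mul_apply]
  rfl

theorem col_mul {ι κ τ : Type*} [Fintype κ] (A : Matrix τ κ ℝ) (B : Matrix κ ι ℝ) (a : ι) :
    (A * B).col a = A *ᵥ B.col a := rfl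

variable {n np nd ne : Type} [Fintype n] [Fintype np] [Fintype ne] [DecidableEq n]
  [DecidableEq np] (G : LFTSystem n np nd ne)

/-- The matrices `(Θ, L, Z)` of an anticausal filter `μ(k) = L μ(k + 1) + R b(k)`, `ζ = Z μ`,
whose output energy bounds the worst-case output energy of a dissipative system. -/
theorem LFTSystem.exists_filter {R R' : Matrix n n ℝ} {Y : Matrix np np ℝ}
    (hDl : (R' - R).PosDef) (hH : (G.dissipationMatrix R Y).PosDef)
    (hH' : (G.dissipationMatrix R' Y).PosDef) :
    ∃ (L : Matrix n n ℝ) (Z : Matrix (n ⊕ np) n ℝ) (κ : ℝ), 0 ≤ κ ∧ κ < 1 ∧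
      G.stateMatrixᵀ - (Matrix.fromCols 1 0 : Matrix n (n ⊕ np) ℝ)ᵀ * L = G.dissipationMatrix R Y * Z ∧
      ∀ μ : n → ℝ, (L *ᵥ μ) ⬝ᵥ (R' - R)⁻¹ *ᵥ (L *ᵥ μ)
        + (Z *ᵥ μ) ⬝ᵥ G.dissipationMatrix R Y *ᵥ (Z *ᵥ μ) ≤ κ * (μ ⬝ᵥ (R' - R)⁻¹ *ᵥ μ) := by
  set Dl := R' - R with hDl_def
  set E : Matrix n (n ⊕ np) ℝ := Matrix.fromCols 1 0 with hE
  set H := G.dissipationMatrix R Y with hH_def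
  set H' := G.dissipationMatrix R' Y with hH'_def
  set Γ := G.stateMatrix with hΓ
  -- Since `R'` exceeds `R` by `Dl`, also `S = H' + Γᵀ Dl Γ`. The first expression yields the
  -- equation for `L` and `Z`, the second the Lyapunov inequality.
  set S := Eᵀ * Dl * E + H with hS_def
  have hEDE : Eᵀ * Dl * E = Matrix.fromBlocks Dl 0 0 0 := by
    rw [hE, Matrix.transpose_fromCols, Matrix.fromRows_mul, Matrix.fromRows_mul_fromCols]
    simp
  have hS : S.PosDef := by
    rw [hS_def, add_comm]
    refine hH.add_posSemidef ?_
    have := hDl.posSemidef.conjTranspose_mul_mul_same E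
    simpa using this
  have hSH : S - Γᵀ * Dl * Γ = H' := by
    have hb : Matrix.fromBlocks Dl 0 0 0 + Matrix.fromBlocks R 0 0 Y
        = Matrix.fromBlocks R' 0 0 Y := by
      rw [Matrix.fromBlocks_add, hDl_def]
      simp
    rw [hS_def, hEDE, hH'_def, hH_def, LFTSystem.dissipationMatrix, LFTSystem.dissipationMatrix,
      ← hb, hDl_def, Matrix.mul_sub, Matrix.sub_mul]
    abel
  set Z := S⁻¹ * Γᵀ with hZ
  have hSZ : S * Z = Γᵀ := by rw [hZ, ← Matrix.mul_assoc, posDef_mul_inv hS, Matrix.one_mul]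
  set L := Dl * (E * Z) with hL
  -- Strictness of `H'` gives `ε S ≤ H'`, from which the rate `κ = 1 / (1 + ε)` results.
  obtain ⟨ε, hε, hεS⟩ := exists_mul_dotProduct_le hH' S
  refine ⟨L, Z, 1 / (1 + ε), by positivity, (div_lt_one (by positivity)).2 (by linarith), ?_,
    fun μ => ?_⟩
  · rw [sub_eq_iff_eq_add, hL, ← hSZ, hS_def, Matrix.add_mul, add_comm]
    simp only [Matrix.mul_assoc]
  set z := Z *ᵥ μ with hz
  have hLμ : L *ᵥ μ = Dl *ᵥ (E *ᵥ z) := by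
    rw [hz, Matrix.mulVec_mulVec, Matrix.mulVec_mulVec, hL, Matrix.mul_assoc]
  have hΘD : Dl⁻¹ * Dl = 1 := posDef_inv_mul hDl
  have e1 : (L *ᵥ μ) ⬝ᵥ Dl⁻¹ *ᵥ (L *ᵥ μ) = z ⬝ᵥ (Eᵀ * Dl * E) *ᵥ z := by
    rw [dotProduct_transpose_mul_mul_mulVec, hLμ, Matrix.mulVec_mulVec _ Dl⁻¹, hΘD,
      Matrix.one_mulVec, dotProduct_comm]
  have e2 : (L *ᵥ μ) ⬝ᵥ Dl⁻¹ *ᵥ (L *ᵥ μ) + z ⬝ᵥ H *ᵥ z = z ⬝ᵥ S *ᵥ z := by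
    rw [e1, ← dotProduct_add, ← Matrix.add_mulVec]
  have e3 : z ⬝ᵥ S *ᵥ z = (Γ *ᵥ z) ⬝ᵥ μ := by
    conv_lhs => rw [hz, Matrix.mulVec_mulVec, hSZ, Matrix.mulVec_transpose, dotProduct_comm,
      ← Matrix.dotProduct_mulVec, dotProduct_comm, ← hz]
  have e4 : z ⬝ᵥ H' *ᵥ z = z ⬝ᵥ S *ᵥ z - (Γ *ᵥ z) ⬝ᵥ Dl *ᵥ (Γ *ᵥ z) := by
    rw [← hSH, Matrix.sub_mulVec, dotProduct_sub, dotProduct_transpose_mul_mul_mulVec]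
  -- This square gives `μ·Dl⁻¹ μ ≥ 2 (Γ z)·μ - (Γ z)·Dl (Γ z)`. By `e3` and `e4` the right side is
  -- `z·S z + z·H' z`, at least `(1 + ε) z·S z`.
  have h5 := posSemidef_dotProduct_nonneg hDl.inv.posSemidef (μ - Dl *ᵥ (Γ *ᵥ z))
  have e6 : Dl⁻¹ *ᵥ (Dl *ᵥ (Γ *ᵥ z)) = Γ *ᵥ z := by
    rw [Matrix.mulVec_mulVec, hΘD, Matrix.one_mulVec]
  have e7 : (Dl *ᵥ (Γ *ᵥ z)) ⬝ᵥ Dl⁻¹ *ᵥ μ = (Γ *ᵥ z) ⬝ᵥ μ := by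
    rw [dotProduct_mulVec_comm (posDef_transpose_eq hDl.inv), e6, dotProduct_comm]
  rw [Matrix.mulVec_sub, e6, dotProduct_sub, sub_dotProduct, sub_dotProduct, e7,
    dotProduct_comm μ (Γ *ᵥ z), dotProduct_comm (Dl *ᵥ (Γ *ᵥ z)) (Γ *ᵥ z)] at h5
  have h8 := hεS z
  rw [e2, div_mul_eq_mul_div, one_mul, le_div_iff₀ (by positivity)]
  linarith

end FilterMatrices

/-! ### Finite filters driven by white noise, and truncation of the anticausal filter -/

section FilterSignals

/-- A functional of signals whose values at unit white noise are asymptotically at most `c / p`. -/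
def WhiteNoiseBound {p : ℕ} (φ : Signal (Fin p) → ℝ) (c : ℝ) : Prop :=
  ∃ E : ℝ, ∀ (η : ℝ) (f : Signal (Fin p)), f ∈ whiteNoiseSet p η → ‖f‖ = 1 → φ f ≤ c / p + E * η

namespace WhiteNoiseBound

variable {p : ℕ} {φ ψ : Signal (Fin p) → ℝ} {c c' : ℝ}

theorem add (h : WhiteNoiseBound φ c) (h' : WhiteNoiseBound ψ c') :
    WhiteNoiseBound (fun f => φ f + ψ f) (c + c') := by
  obtain ⟨E, h⟩ := h
  obtain ⟨E', h'⟩ := h'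
  refine ⟨E + E', fun η f hf hn => ?_⟩
  have := h η f hf hn
  have := h' η f hf hn
  rw [add_div, add_mul]
  linarith

theorem const_mul {a : ℝ} (ha : 0 ≤ a) (h : WhiteNoiseBound φ c) :
    WhiteNoiseBound (fun f => a * φ f) (a * c) := by
  obtain ⟨E, h⟩ := h
  refine ⟨a * E, fun η f hf hn => ?_⟩
  have := mul_le_mul_of_nonneg_left (h η f hf hn) ha
  rw [mul_div_assoc, mul_assoc]
  linarith

theorem sum {α : Type*} (s : Finset α) {φ : α → Signal (Fin p) → ℝ} {c : α → ℝ}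
    (h : ∀ i ∈ s, WhiteNoiseBound (φ i) (c i)) :
    WhiteNoiseBound (fun f => ∑ i ∈ s, φ i f) (∑ i ∈ s, c i) := by
  classical
  induction s using Finset.induction_on with
  | empty => exact ⟨0, fun η f _ _ => by simp⟩
  | insert i s hi ih =>
    simp only [Finset.sum_insert hi]
    exact (h i (Finset.mem_insert_self i s)).add
      (ih fun j hj => h j (Finset.mem_insert_of_mem hj))

theorem mono (h : WhiteNoiseBound φ c) (hφ : ∀ f, ψ f ≤ φ f) (hc : c ≤ c') :
    WhiteNoiseBound ψ c' := by
  obtain ⟨E, h⟩ := h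
  refine ⟨E, fun η f hf hn => (hφ f).trans ((h η f hf hn).trans ?_)⟩
  gcongr

/-- Unit white noise behaves as if distinct delays were uncorrelated and equal delays had covariance
`I / p`; the error constant depends only on `U`, `i`, `j`. -/
theorem inner_matSig (U : Matrix (Fin p) (Fin p) ℝ) (i j : ℕ) :
    WhiteNoiseBound (fun f => ⟪rightShift^[i] f, matSig U (rightShift^[j] f)⟫_ℝ)
      (if i = j then U.trace else 0) := by
  refine ⟨(∑ a, ∑ b, |U a b|) * (1 + 2 * Real.pi * (i + j)), fun η f hf hn => ?_⟩
  refine (inner_iterate_rightShift_matSig_le hf U i j).trans (le_of_eq ?_)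
  rw [hn]
  split_ifs <;> ring

/-- The energy of a linear combination of delayed white-noise signals. -/
theorem inner_sum_matSig {ι : Type} [Fintype ι] (H : Matrix ι ι ℝ) (K : ℕ → Matrix ι (Fin p) ℝ)
    (N : ℕ) (τ : ℕ → ℕ) (hτ : Set.InjOn τ (Finset.range N)) :
    WhiteNoiseBound (fun f => ⟪∑ i ∈ Finset.range N, matSig (K i) (rightShift^[τ i] f),
        matSig H (∑ i ∈ Finset.range N, matSig (K i) (rightShift^[τ i] f))⟫_ℝ)
      (∑ i ∈ Finset.range N, ((K i)ᵀ * H * K i).trace) := by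
  have h : WhiteNoiseBound (fun f => ∑ i ∈ Finset.range N, ∑ j ∈ Finset.range N,
      ⟪rightShift^[τ i] f, matSig ((K i)ᵀ * H * K j) (rightShift^[τ j] f)⟫_ℝ)
      (∑ i ∈ Finset.range N, ∑ j ∈ Finset.range N,
        if τ i = τ j then ((K i)ᵀ * H * K j).trace else 0) :=
    sum _ fun i _ => sum _ fun j _ => inner_matSig _ _ _
  refine h.mono (fun f => le_of_eq ?_) (le_of_eq ?_)
  · rw [sum_inner]
    refine Finset.sum_congr rfl fun i _ => ?_
    rw [map_sum, inner_sum]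
    refine Finset.sum_congr rfl fun j _ => ?_
    rw [RobustH2.inner_matSig, matSig_matSig, matSig_matSig, Matrix.mul_assoc]
  -- Distinct delays, by injectivity of `τ`, remove the off-diagonal terms.
  · refine Finset.sum_congr rfl fun i hi => ?_
    rw [Finset.sum_eq_single i]
    · rw [if_pos rfl]
    · intro j hj hji
      exact if_neg fun h => hji (hτ hj hi h.symm)
    · intro h; exact absurd hi h

end WhiteNoiseBound

section Shifts

variable {E : Type*} [NormedAddCommGroup E] [NormedSpace ℝ E]

/-- Lets advances be rewritten as a common advance of delays, for which the correlation estimates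
are available. -/
theorem leftShift_iterate_rightShift_iterate {i N : ℕ} (h : i ≤ N) (x : lp (fun _ : ℕ => E) 2) :
    leftShift^[N] (rightShift^[N - i] x) = leftShift^[i] x := by
  obtain ⟨k, rfl⟩ := Nat.exists_eq_add_of_le h
  rw [Nat.add_sub_cancel_left, Function.iterate_add_apply]
  congr 1
  exact (Function.LeftInverse.iterate leftShift_rightShift k) x

theorem norm_iterate_leftShift_le (i : ℕ) (x : lp (fun _ : ℕ => E) 2) :
    ‖leftShift^[i] x‖ ≤ ‖x‖ := by
  induction i with
  | zero => rfl
  | succ i ih =>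
    rw [Function.iterate_succ_apply']
    exact (norm_leftShift_le _).trans ih

end Shifts

section

variable {ι κ : Type} [Fintype ι] [Fintype κ]

theorem matSig_iterate_leftShift (A : Matrix κ ι ℝ) (i : ℕ) (x : Signal ι) :
    matSig A (leftShift^[i] x) = leftShift^[i] (matSig A x) := by
  induction i with
  | zero => rfl
  | succ i ih => rw [Function.iterate_succ_apply', Function.iterate_succ_apply', ← ih,
      matSig_leftShift]

theorem inner_iterate_rightShift (i : ℕ) (x y : Signal ι) :
    ⟪rightShift^[i] x, y⟫_ℝ = ⟪x, leftShift^[i] y⟫_ℝ := by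
  induction i generalizing y with
  | zero => rfl
  | succ i ih => rw [Function.iterate_succ_apply', inner_rightShift, ih,
      Function.iterate_succ_apply]

theorem inner_matSig_iterate_leftShift_le {H : Matrix ι ι ℝ} (hH : H.PosSemidef) (i : ℕ)
    (x : Signal ι) : ⟪leftShift^[i] x, matSig H (leftShift^[i] x)⟫_ℝ ≤ ⟪x, matSig H x⟫_ℝ := by
  induction i with
  | zero => rfl
  | succ i ih =>
    rw [Function.iterate_succ_apply']
    exact (inner_matSig_leftShift_le hH _).trans ih

theorem iterate_leftShift_sum {α : Type*} (s : Finset α) (g : α → Signal ι) (i : ℕ) :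
    leftShift^[i] (∑ a ∈ s, g a) = ∑ a ∈ s, leftShift^[i] (g a) := by
  induction i generalizing g with
  | zero => rfl
  | succ i ih => simp only [Function.iterate_succ_apply, map_sum, ih]

theorem matSig_neg (A : Matrix κ ι ℝ) (x : Signal ι) : matSig (-A) x = -matSig A x := by
  rw [← neg_one_smul ℝ A, matSig_smul, neg_one_smul]

end

section Filter

variable {n nd : Type} [Fintype n] [Fintype nd] [DecidableEq n]

/-- The output of the truncated anticausal filter `μ(k) = ∑_{j < N} L^j B d(k + j)`. -/
def anticausalFilter (L : Matrix n n ℝ) (B : Matrix n nd ℝ) (N : ℕ) (d : Signal nd) : Signal n :=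
  ∑ j ∈ Finset.range N, matSig (L ^ j * B) (leftShift^[j] d)

/-- The sum telescopes; the last term is the price of stopping the filter after `N` steps. -/
theorem matSig_eq_anticausalFilter_sub (L : Matrix n n ℝ) (B : Matrix n nd ℝ) (N : ℕ)
    (d : Signal nd) :
    matSig B d = anticausalFilter L B N d - leftShift (matSig L (anticausalFilter L B N d))
      + matSig (L ^ N * B) (leftShift^[N] d) := by
  have h : leftShift (matSig L (anticausalFilter L B N d))
      = ∑ j ∈ Finset.range N, matSig (L ^ (j + 1) * B) (leftShift^[j + 1] d) := by
    rw [anticausalFilter, map_sum, map_sum]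
    refine Finset.sum_congr rfl fun j _ => ?_
    rw [matSig_matSig, ← matSig_leftShift, ← Function.iterate_succ_apply' leftShift,
      ← Matrix.mul_assoc, ← pow_succ']
  have h2 := Finset.sum_range_succ' (fun j => matSig (L ^ j * B) (leftShift^[j] d)) N
  rw [Finset.sum_range_succ] at h2
  rw [h, anticausalFilter, sub_add_eq_add_sub, h2]
  simp

/-- The matrix `L` contracts the `Θ`-energy by `κ < 1` pointwise, hence on signals; since that
energy is comparable with the squared norm, the truncation remainder can be made arbitrarily small.
-/
theorem exists_norm_matSig_pow_le {L Θ : Matrix n n ℝ} (hΘ : Θ.PosDef) {κ : ℝ} (hκ0 : 0 ≤ κ)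
    (hκ : κ < 1) (hL : ∀ μ : n → ℝ, (L *ᵥ μ) ⬝ᵥ Θ *ᵥ (L *ᵥ μ) ≤ κ * (μ ⬝ᵥ Θ *ᵥ μ))
    (B : Matrix n nd ℝ) {δ : ℝ} (hδ : 0 < δ) :
    ∃ N : ℕ, 0 < N ∧ ∀ d : Signal nd, ‖matSig (L ^ N * B) (leftShift^[N] d)‖ ≤ δ * ‖d‖ := by
  have hstep : ∀ s : Signal n, ⟪matSig L s, matSig Θ (matSig L s)⟫_ℝ ≤ κ * ⟪s, matSig Θ s⟫_ℝ := by
    intro s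
    have hps : (κ • Θ - Lᵀ * Θ * L).PosSemidef := by
      refine .of_dotProduct_mulVec_nonneg ?_ fun v => ?_
      · have ht := posDef_transpose_eq hΘ
        rw [Matrix.IsHermitian, Matrix.conjTranspose_eq_transpose_of_trivial]
        simp [Matrix.transpose_mul, ht, Matrix.mul_assoc]
      · rw [star_trivial, Matrix.sub_mulVec, dotProduct_sub, dotProduct_transpose_mul_mul_mulVec,
          Matrix.smul_mulVec, dotProduct_smul, smul_eq_mul]
        linarith [hL v]
    have := inner_matSig_nonneg hps s
    rw [matSig_sub, matSig_smul, inner_sub_right, real_inner_smul_right] at this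
    rw [inner_matSig, matSig_matSig, matSig_matSig]
    linarith
  have hpow : ∀ (N : ℕ) (s : Signal n), ⟪matSig (L ^ N) s, matSig Θ (matSig (L ^ N) s)⟫_ℝ
      ≤ κ ^ N * ⟪s, matSig Θ s⟫_ℝ := by
    intro N s
    induction N with
    | zero => simp [matSig_one]
    | succ N ih =>
      rw [pow_succ' L, ← matSig_matSig]
      refine (hstep _).trans ?_
      rw [pow_succ', mul_assoc]
      exact mul_le_mul_of_nonneg_left ih hκ0
  obtain ⟨c, hc, hc'⟩ := exists_pos_mul_norm_sq_le hΘ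
  set K : ℝ := ‖matSig Θ‖ * ‖matSig B‖ ^ 2 with hK
  obtain ⟨N, hN⟩ := exists_pow_lt_of_lt_one (show 0 < c * δ ^ 2 / (K + 1) by positivity) hκ
  -- The successor guarantees that the filter retains its term `j = 0`, the only one correlated with
  -- the present disturbance.
  refine ⟨N + 1, N.succ_pos, fun d => ?_⟩
  set s := matSig B (leftShift^[N + 1] d) with hs
  have h1 : ‖s‖ ≤ ‖matSig B‖ * ‖d‖ :=
    ((matSig B).le_opNorm _).trans (by gcongr; exact norm_iterate_leftShift_le _ _)
  have h2 : ⟪s, matSig Θ s⟫_ℝ ≤ K * ‖d‖ ^ 2 := by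
    calc ⟪s, matSig Θ s⟫_ℝ ≤ ‖s‖ * (‖matSig Θ‖ * ‖s‖) :=
          (real_inner_le_norm _ _).trans (by gcongr; exact (matSig Θ).le_opNorm _)
      _ = ‖matSig Θ‖ * ‖s‖ ^ 2 := by ring
      _ ≤ ‖matSig Θ‖ * (‖matSig B‖ * ‖d‖) ^ 2 := by gcongr
      _ = K * ‖d‖ ^ 2 := by rw [hK]; ring
  have h3 : κ ^ (N + 1) * (K + 1) ≤ c * δ ^ 2 := by
    have h4 : κ ^ (N + 1) ≤ κ ^ N := pow_le_pow_of_le_one hκ0 hκ.le N.le_succ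
    rw [lt_div_iff₀ (by positivity)] at hN
    exact (mul_le_mul_of_nonneg_right h4 (by positivity)).trans hN.le
  rw [← matSig_matSig, ← hs]
  refine abs_le_of_sq_le_sq' ?_ (by positivity) |>.2
  refine le_of_mul_le_mul_left ?_ hc
  calc c * ‖matSig (L ^ (N + 1)) s‖ ^ 2 ≤ κ ^ (N + 1) * ⟪s, matSig Θ s⟫_ℝ :=
        (hc' _).trans (hpow _ _)
    _ ≤ κ ^ (N + 1) * (K * ‖d‖ ^ 2) := by gcongr
    _ ≤ κ ^ (N + 1) * (K + 1) * ‖d‖ ^ 2 := by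
        have := mul_nonneg (pow_nonneg hκ0 (N + 1)) (sq_nonneg ‖d‖)
        linarith
    _ ≤ c * δ ^ 2 * ‖d‖ ^ 2 := by gcongr
    _ = c * (δ * ‖d‖) ^ 2 := by ring

end Filter

end FilterSignals

/-! ### Energy of the filter and passage to the `H₂` norm -/

section EnergyBound

/-- Distinct advances decorrelate, so the filter energy is a sum over impulse-response coefficients,
which the Lyapunov inequality telescopes to at most `tr (R B)ᵀ Θ (R B)`. Of `2⟪B d, μ⟫` only the
term `j = 0` counts, and subtracting `⟪B d, R B d⟫` leaves one `tr Bᵀ R B`. -/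
theorem whiteNoiseBound_anticausalFilter {n κ : Type} [Fintype n] [DecidableEq n] [Fintype κ]
    {p : ℕ} {R L Θ : Matrix n n ℝ} {Z : Matrix κ n ℝ} {H : Matrix κ κ ℝ} (hR : Rᵀ = R)
    (hΘ : Θ.PosSemidef) (hH : H.PosSemidef)
    (hL : ∀ μ : n → ℝ, (L *ᵥ μ) ⬝ᵥ Θ *ᵥ (L *ᵥ μ) + (Z *ᵥ μ) ⬝ᵥ H *ᵥ (Z *ᵥ μ) ≤ μ ⬝ᵥ Θ *ᵥ μ)
    (B : Matrix n (Fin p) ℝ) {N : ℕ} (hN : 0 < N) :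
    WhiteNoiseBound (fun d => ⟪matSig Z (anticausalFilter L (R * B) N d),
          matSig H (matSig Z (anticausalFilter L (R * B) N d))⟫_ℝ
        + (2 * ⟪matSig B d, anticausalFilter L (R * B) N d⟫_ℝ
          - ⟪matSig B d, matSig (R * B) d⟫_ℝ))
      (Bᵀ * (R * Θ * R + R) * B).trace := by
  set K : ℕ → Matrix κ (Fin p) ℝ := fun j => Z * (L ^ j * (R * B)) with hK
  have h1 := WhiteNoiseBound.inner_sum_matSig H K N (fun j => N - j) fun i hi j hj h => by
    simp only [Finset.coe_range, Set.mem_Iio] at hi hj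
    simp only at h
    omega
  have h2 : WhiteNoiseBound (fun d => ∑ j ∈ Finset.range N,
      ⟪rightShift^[j] d, matSig (Bᵀ * (L ^ j * (R * B))) (rightShift^[0] d)⟫_ℝ)
      (∑ j ∈ Finset.range N, if j = 0 then (Bᵀ * (L ^ j * (R * B))).trace else 0) :=
    WhiteNoiseBound.sum _ fun j _ => WhiteNoiseBound.inner_matSig _ _ _
  have h3 := WhiteNoiseBound.inner_matSig (-(Bᵀ * (R * B))) 0 0
  refine (h1.add ((h2.const_mul zero_le_two).add h3)).mono (fun d => ?_) ?_
  · refine add_le_add ?_ (le_of_eq ?_)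
    -- The common advance by `N` drops initial samples, which can only lower an `H`-energy.
    · have e : matSig Z (anticausalFilter L (R * B) N d)
          = leftShift^[N] (∑ j ∈ Finset.range N, matSig (K j) (rightShift^[N - j] d)) := by
        rw [iterate_leftShift_sum, anticausalFilter, map_sum]
        refine Finset.sum_congr rfl fun j hj => ?_
        rw [← matSig_iterate_leftShift,
          leftShift_iterate_rightShift_iterate (Finset.mem_range.1 hj).le, matSig_matSig]
      rw [e]
      exact inner_matSig_iterate_leftShift_le hH N _
    · rw [sub_eq_add_neg]
      congr 1
      · congr 1
        rw [anticausalFilter, inner_sum]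
        refine Finset.sum_congr rfl fun j _ => ?_
        rw [Function.iterate_zero_apply, inner_matSig, matSig_matSig, matSig_iterate_leftShift,
          ← inner_iterate_rightShift]
      · rw [Function.iterate_zero_apply, matSig_neg, inner_neg_right, inner_matSig, matSig_matSig]
  · have e1 : ∑ j ∈ Finset.range N, ((K j)ᵀ * H * K j).trace
        ≤ ((R * B)ᵀ * Θ * (R * B)).trace := by
      simp only [trace_transpose_mul_mul]
      rw [Finset.sum_comm]
      refine Finset.sum_le_sum fun a _ => ?_
      set v := (R * B).col a
      have hcol : ∀ j, (K j).col a = Z *ᵥ (L ^ j *ᵥ v) := fun j => by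
        rw [hK, col_mul, col_mul]
      simp only [hcol]
      have htel : ∀ M : ℕ, (L ^ M *ᵥ v) ⬝ᵥ Θ *ᵥ (L ^ M *ᵥ v)
          + ∑ j ∈ Finset.range M, (Z *ᵥ (L ^ j *ᵥ v)) ⬝ᵥ H *ᵥ (Z *ᵥ (L ^ j *ᵥ v))
          ≤ v ⬝ᵥ Θ *ᵥ v := fun M => by
        induction M with
        | zero => simp
        | succ M ih =>
          have h := hL (L ^ M *ᵥ v)
          rw [Matrix.mulVec_mulVec, ← pow_succ'] at h
          rw [Finset.sum_range_succ]
          linarith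
      have := posSemidef_dotProduct_nonneg hΘ (L ^ N *ᵥ v)
      linarith [htel N]
    have e2 : (∑ j ∈ Finset.range N, if j = 0 then (Bᵀ * (L ^ j * (R * B))).trace else 0)
        = (Bᵀ * (R * B)).trace := by
      rw [Finset.sum_ite_eq' (Finset.range N) 0, if_pos (Finset.mem_range.2 hN), pow_zero,
        Matrix.one_mul]
    have e3 : (Bᵀ * (R * Θ * R + R) * B).trace
        = ((R * B)ᵀ * Θ * (R * B)).trace + (Bᵀ * (R * B)).trace := by
      rw [← Matrix.trace_add, Matrix.transpose_mul, hR, Matrix.mul_add, Matrix.add_mul]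
      simp only [Matrix.mul_assoc]
    rw [e2, e3, if_pos rfl, Matrix.trace_neg]
    linarith

namespace LFTSystem

variable {n np nd ne : Type} [Fintype n] [Fintype np] [Fintype nd] [Fintype ne] [DecidableEq n]
  [DecidableEq np] (G : LFTSystem n np nd ne)

/-- The output energy is bounded by that of the anticausal filter. -/
theorem norm_sq_output_le {R L : Matrix n n ℝ} {Y : Matrix np np ℝ} {Z : Matrix (n ⊕ np) n ℝ}
    (hR : Rᵀ = R) (hH : (G.dissipationMatrix R Y).PosSemidef)
    (hZ : G.stateMatrixᵀ - (Matrix.fromCols 1 0 : Matrix n (n ⊕ np) ℝ)ᵀ * L = G.dissipationMatrix R Y * Z)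
    {Δ : Signal np →L[ℝ] Signal np} (hΔ : ∀ q, ⟪Δ q, matSig Y (Δ q)⟫_ℝ ≤ ⟪q, matSig Y q⟫_ℝ)
    {d : Signal nd} {x : Signal n} {p q : Signal np} {e : Signal ne}
    (h : G.IsTrajectory Δ 0 d 0 x p q e) (N : ℕ) :
    ‖e‖ ^ 2 ≤ ⟪matSig Z (anticausalFilter L (R * G.B₁) N d), matSig (G.dissipationMatrix R Y)
          (matSig Z (anticausalFilter L (R * G.B₁) N d))⟫_ℝ
        + (2 * ⟪matSig G.B₁ d, anticausalFilter L (R * G.B₁) N d⟫_ℝ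
          - ⟪matSig G.B₁ d, matSig (R * G.B₁) d⟫_ℝ)
        + 2 * (‖x‖ * ‖matSig (L ^ N * (R * G.B₁)) (leftShift^[N] d)‖) := by
  obtain ⟨heq, hp⟩ := h
  obtain ⟨hx, hq, he⟩ := G.equations_iff.1 heq
  rw [add_zero] at hp
  set z := pairSig x p with hz
  set y := matSig G.stateMatrix z with hy
  set b := matSig G.B₁ d with hb
  set μ := anticausalFilter L (R * G.B₁) N d with hμ
  set t := matSig (L ^ N * (R * G.B₁)) (leftShift^[N] d) with ht
  set H := G.dissipationMatrix R Y with hHdef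
  have hx0 : x 0 = 0 := heq.1
  have hσx : leftShift x = y + b := by
    conv_lhs => rw [hx]
    rw [lp.single_zero, add_zero, map_add, leftShift_rightShift, leftShift_rightShift]
  have hRb : matSig (R * G.B₁) d = matSig R b := by rw [hb, matSig_matSig]
  have hRb' : matSig R b = μ - leftShift (matSig L μ) + t := by
    rw [← hRb]; exact matSig_eq_anticausalFilter_sub L _ N d
  -- With `x 0 = 0` the left shift preserves the storage energy, and `σx = y + b` is expanded.
  have h1 : ⟪x, matSig R x⟫_ℝ = ⟪y, matSig R y⟫_ℝ + 2 * ⟪leftShift x, matSig R b⟫_ℝ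
      - ⟪b, matSig R b⟫_ℝ := by
    have hs : ⟪b, matSig R y⟫_ℝ = ⟪y, matSig R b⟫_ℝ := by
      rw [← inner_matSig_symm hR, real_inner_comm]
    rw [← inner_leftShift_leftShift hx0, ← matSig_leftShift, hσx, map_add, inner_add_left,
      inner_add_right, inner_add_right, inner_add_left, hs]
    ring
  -- The zero initial state lets the shift in `σ L μ` cancel against that of `σx`; the filter
  -- equation then makes `H` appear.
  have h2 : ⟪leftShift x, matSig R b⟫_ℝ = ⟪z, matSig H (matSig Z μ)⟫_ℝ + ⟪b, μ⟫_ℝ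
      + ⟪leftShift x, t⟫_ℝ := by
    have e1 : ⟪x, matSig L μ⟫_ℝ = ⟪z, matSig ((Matrix.fromCols 1 0 : Matrix n (n ⊕ np) ℝ)ᵀ * L) μ⟫_ℝ := by
      have : x = matSig (Matrix.fromCols 1 0) z := (fstSig_pairSig x p).symm
      conv_lhs => rw [this, inner_matSig, matSig_matSig]
    rw [hRb', inner_add_right, inner_sub_right, inner_leftShift_leftShift hx0, hσx,
      inner_add_left y b μ, hy, inner_matSig, e1, matSig_matSig, ← hZ, matSig_sub,
      inner_sub_right]
    ring
  -- Completing the square removes the unknown `z`, and with it the dependence on `Δ`.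
  have h3 : 2 * ⟪z, matSig H (matSig Z μ)⟫_ℝ - ⟪z, matSig H z⟫_ℝ
      ≤ ⟪matSig Z μ, matSig H (matSig Z μ)⟫_ℝ := by
    have hs : ⟪matSig Z μ, matSig H z⟫_ℝ = ⟪z, matSig H (matSig Z μ)⟫_ℝ := by
      have hHt : Hᵀ = H := by
        have := hH.1
        rwa [Matrix.IsHermitian, Matrix.conjTranspose_eq_transpose_of_trivial] at this
      rw [← inner_matSig_symm hHt, real_inner_comm]
    have := inner_matSig_nonneg hH (z - matSig Z μ)
    rw [map_sub, inner_sub_left, inner_sub_right, inner_sub_right, hs] at this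
    linarith
  have h4 : ⟪leftShift x, t⟫_ℝ ≤ ‖x‖ * ‖t‖ :=
    (real_inner_le_norm _ _).trans (by gcongr; exact norm_leftShift_le x)
  have h5 := G.inner_dissipationMatrix R Y z
  have h6 : ⟪z, matSig (Matrix.fromBlocks R 0 0 Y) z⟫_ℝ
      = ⟪x, matSig R x⟫_ℝ + ⟪p, matSig Y p⟫_ℝ := by
    rw [hz, matSig_fromBlocks_pairSig, inner_pairSig]
  have h7 := hΔ q
  rw [← hp] at h7
  rw [← hq, ← he, h6, ← hHdef] at h5
  rw [hRb]
  linarith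

end LFTSystem

/-- By monotonicity the limit of the gains is at most the gain at any single `η > 0`; choosing `η`
with `E * η ≤ δ` accounts for the second `δ`. -/
theorem h2Norm_le {p q : ℕ} {T : Signal (Fin p) → Signal (Fin q)} {E δ c : ℝ} (hδ : 0 < δ)
    (hT : ∀ (η : ℝ) (f : Signal (Fin p)), f ∈ whiteNoiseSet p η → ‖f‖ = 1 →
      ‖T f‖ ^ 2 ≤ c / p + E * η + δ) :
    h2Norm T ≤ ENNReal.ofReal (Real.sqrt (c + 2 * p * δ)) := by
  rcases Nat.eq_zero_or_pos p with rfl | hp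
  · simp [h2Norm]
  set η : ℝ := δ / (|E| + 1) with hη
  have hη0 : 0 < η := by positivity
  have hEη : E * η ≤ δ := by
    rw [hη, mul_div_assoc', div_le_iff₀ (by positivity), mul_comm δ]
    exact mul_le_mul_of_nonneg_right ((le_abs_self E).trans (by linarith)) hδ.le
  have hlim : limUnder (𝓝[>] (0 : ℝ)) (whiteNoiseGain T) ≤ whiteNoiseGain T η := by
    refine le_of_tendsto (tendsto_whiteNoiseGain T) ?_
    filter_upwards [Ioo_mem_nhdsGT hη0] with η' hη'
    exact whiteNoiseGain_mono T hη'.2.le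
  have hgain : whiteNoiseGain T η ≤ ENNReal.ofReal (Real.sqrt (c / p + 2 * δ)) := by
    refine iSup₂_le fun f hf => ENNReal.ofReal_le_ofReal (Real.le_sqrt_of_sq_le ?_)
    linarith [hT η f hf.1 hf.2]
  have hp' : (0 : ℝ) < p := by exact_mod_cast hp
  calc h2Norm T ≤ ENNReal.ofReal (Real.sqrt p) * ENNReal.ofReal (Real.sqrt (c / p + 2 * δ)) :=
        mul_le_mul_right (hlim.trans hgain) _
    _ = ENNReal.ofReal (Real.sqrt (c + 2 * p * δ)) := by
        rw [← ENNReal.ofReal_mul (Real.sqrt_nonneg _), ← Real.sqrt_mul hp'.le]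
        congr 2
        field_simp

end EnergyBound

namespace LFTSystem

/-- Strict dissipativity for two storage matrices bounds the robust `H₂` norm. -/
theorem exists_robustH2Norm_lt {n np : Type} [Fintype n] [Fintype np] [DecidableEq n]
    [DecidableEq np] {nd ne : ℕ} (G : LFTSystem n np (Fin nd) (Fin ne))
    {U : Set (Signal np →L[ℝ] Signal np)} {P P' : Matrix n n ℝ} {Y : Matrix np np ℝ}
    {Q : Matrix (Fin nd) (Fin nd) ℝ} {γ : ℝ} (hγ : 0 < γ) (hP : P.PosDef) (hP' : P'.PosDef)
    (hY : Y.PosDef) (hH : (G.dissipationMatrix P⁻¹ Y).PosDef)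
    (hH' : (G.dissipationMatrix P'⁻¹ Y).PosDef)
    (hU : ∀ Δ ∈ U, ∀ q, ⟪Δ q, matSig Y (Δ q)⟫_ℝ ≤ ⟪q, matSig Y q⟫_ℝ)
    (hQ : (Matrix.fromBlocks Q G.B₁ᵀ G.B₁ (P' - P)).PosDef) (htr : Q.trace < γ ^ 2) :
    ∃ T : (Signal np →L[ℝ] Signal np) → (Signal (Fin nd) →L[ℝ] Signal (Fin ne)),
      (∀ Δ ∈ U, G.IsDisturbanceMap Δ (T Δ)) ∧
      robustH2Norm U (fun Δ => T Δ) < ENNReal.ofReal γ := by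
  obtain ⟨C, T, hC, hT, hx⟩ := G.exists_isDisturbanceMap hP'.inv hY hH' hU
  refine ⟨T, hT, ?_⟩
  have hD : (P' - P).PosDef := by
    have := hQ.submatrix (e := Sum.inr) Sum.inr_injective
    exact this
  have hDl := posDef_inv_sub_inv hP hP' hD
  obtain ⟨L, Z, κ, hκ0, hκ1, hZ, hL⟩ := G.exists_filter hDl hH' hH
  have hLΘ : ∀ μ : n → ℝ, (L *ᵥ μ) ⬝ᵥ (P⁻¹ - P'⁻¹)⁻¹ *ᵥ (L *ᵥ μ)
      ≤ κ * (μ ⬝ᵥ (P⁻¹ - P'⁻¹)⁻¹ *ᵥ μ) := fun μ => by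
    linarith [hL μ, posSemidef_dotProduct_nonneg hH'.posSemidef (Z *ᵥ μ)]
  have hLZ : ∀ μ : n → ℝ, (L *ᵥ μ) ⬝ᵥ (P⁻¹ - P'⁻¹)⁻¹ *ᵥ (L *ᵥ μ)
      + (Z *ᵥ μ) ⬝ᵥ G.dissipationMatrix P'⁻¹ Y *ᵥ (Z *ᵥ μ) ≤ μ ⬝ᵥ (P⁻¹ - P'⁻¹)⁻¹ *ᵥ μ :=
    fun μ => (hL μ).trans (mul_le_of_le_one_left
      (posSemidef_dotProduct_nonneg hDl.inv.posSemidef μ) hκ1.le)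
  -- Schur complement of the coupling condition, followed by the trace.
  have htrace : (G.B₁ᵀ * (P' - P)⁻¹ * G.B₁).trace ≤ Q.trace := by
    let _ : Invertible (P' - P) := hD.isUnit.invertible
    have h := (Matrix.PosDef.fromBlocks₂₂ Q G.B₁ᵀ hD).1 (by
      rw [Matrix.conjTranspose_eq_transpose_of_trivial, Matrix.transpose_transpose]
      exact hQ.posSemidef)
    have h2 := h.trace_nonneg
    rw [Matrix.conjTranspose_eq_transpose_of_trivial, Matrix.transpose_transpose,
      Matrix.trace_sub] at h2
    linarith
  -- Chosen so that `2 * nd * δ` uses at most half of the gap `γ ^ 2 - Q.trace`; the `+ 1` covers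
  -- `nd = 0`.
  set δ : ℝ := (γ ^ 2 - Q.trace) / (4 * (nd + 1)) with hδ_def
  have hδ : 0 < δ := div_pos (by linarith) (by positivity)
  -- The truncation length, and after it the error constant `E`, are fixed before `Δ`; with `‖x‖ ≤
  -- C` the remainder costs at most `δ`.
  obtain ⟨N, hN, hNd⟩ := exists_norm_matSig_pow_le hDl.inv hκ0 hκ1 hLΘ (P'⁻¹ * G.B₁)
    (show 0 < δ / (2 * (C + 1)) by positivity)
  obtain ⟨E, hE⟩ := whiteNoiseBound_anticausalFilter (posDef_transpose_eq hP'.inv)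
    hDl.inv.posSemidef hH'.posSemidef hLZ G.B₁ hN
  have hbound : robustH2Norm U (fun Δ => T Δ)
      ≤ ENNReal.ofReal (Real.sqrt (Q.trace + 2 * nd * δ)) := by
    refine iSup₂_le fun Δ hΔ => h2Norm_le (E := E) hδ fun η f hf hf1 => ?_
    obtain ⟨x, p, q, htraj, hxb⟩ := hx Δ hΔ f
    have h1 := G.norm_sq_output_le (posDef_transpose_eq hP'.inv) hH'.posSemidef hZ (hU Δ hΔ)
      htraj N
    have h2 := hE η f hf hf1
    rw [inv_mul_inv_sub_inv_mul_inv hP hP' hD] at h2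
    have h3 := hNd f
    rw [hf1, mul_one] at hxb h3
    have h4 : ‖x‖ * ‖matSig (L ^ N * (P'⁻¹ * G.B₁)) (leftShift^[N] f)‖
        ≤ C * (δ / (2 * (C + 1))) := mul_le_mul hxb h3 (norm_nonneg _) hC
    have h5 : C * (δ / (2 * (C + 1))) ≤ δ / 2 := by
      rw [mul_div_assoc', div_le_div_iff₀ (by positivity) (by positivity)]
      nlinarith
    have h6 : (G.B₁ᵀ * (P' - P)⁻¹ * G.B₁).trace / nd ≤ Q.trace / nd := by gcongr
    linarith
  refine hbound.trans_lt ((ENNReal.ofReal_lt_ofReal_iff hγ).2 ?_)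
  rw [Real.sqrt_lt' hγ]
  have h7 : 2 * nd * δ ≤ (γ ^ 2 - Q.trace) / 2 := by
    rw [hδ_def, mul_div_assoc', div_le_div_iff₀ (by positivity) (by positivity)]
    nlinarith
  linarith

end LFTSystem

end RobustH2

end

/-! ### The synthesis theorem -/

theorem theorem1 {n nd ne nu s f : ℕ} (m : Fin s → ℕ) (r : Fin f → ℕ)
    (G : RobustH2.LFTPlant (Fin n) (RobustH2.Chan m r) (Fin nd) (Fin ne) (Fin nu))
    (γ : ℝ) (hγ : 0 < γ)
    (Pminus Pplus : Matrix (Fin n) (Fin n) ℝ) (Q : Matrix (Fin nd) (Fin nd) ℝ)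
    (X : Matrix (RobustH2.Chan m r) (RobustH2.Chan m r) ℝ)
    (M : Matrix (Fin nu) (Fin n) ℝ) (V : Matrix (Fin n) (Fin n) ℝ)
    (hPminus : Pminus.PosDef) (hPplus : Pplus.PosDef) (hQ : Q.PosDef)
    (hX : X ∈ RobustH2.scalingSet m r)
    (hLMIplus : (G.synthesisMatrix Pplus X M V).PosDef)
    (hLMIminus : (G.synthesisMatrix Pminus X M V).PosDef)
    (hcoupling : (Matrix.fromBlocks Q G.B₁ᵀ G.B₁ (Pplus - Pminus)).PosDef)
    (htrace : Q.trace < γ ^ 2) :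
    IsUnit V ∧
    (G.closedLoop (M * V⁻¹)).RobustlyStable (RobustH2.uncertaintySet m r) ∧
    ∃ T : (RobustH2.Signal (RobustH2.Chan m r) →L[ℝ] RobustH2.Signal (RobustH2.Chan m r)) →
        (RobustH2.Signal (Fin nd) →L[ℝ] RobustH2.Signal (Fin ne)),
      (∀ Δ ∈ RobustH2.uncertaintySet m r,
        (G.closedLoop (M * V⁻¹)).IsDisturbanceMap Δ (T Δ)) ∧
      RobustH2.robustH2Norm (RobustH2.uncertaintySet m r) (fun Δ => T Δ) < ENNReal.ofReal γ := by
  have hXpos := G.posDef_of_synthesisMatrix_posDef hLMIplus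
  have hHplus := G.dissipationMatrix_posDef hPplus hLMIplus
  have hHminus := G.dissipationMatrix_posDef hPminus hLMIminus
  have hU : ∀ Δ ∈ RobustH2.uncertaintySet m r, ∀ q,
      inner ℝ (Δ q) (RobustH2.matSig X⁻¹ (Δ q)) ≤ inner ℝ q (RobustH2.matSig X⁻¹ q) :=
    fun Δ hΔ => RobustH2.inner_scaling_uncertainty_le (RobustH2.inv_mem_scalingSet hX) hΔ
  exact ⟨G.isUnit_of_synthesisMatrix_posDef hPplus hLMIplus,
    RobustH2.LFTSystem.robustlyStable_of_dissipative _ hPplus.inv hXpos.inv hHplus hU,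
    RobustH2.LFTSystem.exists_robustH2Norm_lt _ hγ hPminus hPplus hXpos.inv hHminus hHplus hU
      hcoupling htrace⟩
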